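/- Theorem 1.3. Let $Q(x,y,z)=ax^2+by^2+cz^2$ with $a,b,c\in\mathbb Z$. Let $p$ be an odd prime with $p\nmid a$, $b=b_0p^{b_1}$, $c=c_0p^{c_1}$, where $0\le b_1\le c_1$ are integers and $b_0,c_0$ are integers with $\gcd(b_0,p)=\gcd(c_0,p)=1$. For an integer $m$ let $r_{n}(m,Q)=\#\{v\in(\mathbb Z/n\mathbb Z)^3: Q(v)\equiv m \pmod n\}$, and let $$\alpha_p(m,Q)=\lim_{U\to\{m\}}\frac{\mathrm{Vol}_{\mathbb Z_p^3}(Q^{-1}(U))}{\mathrm{Vol}_{\mathbb Z_p}(U)}$$ where $U$ runs over open subsets of $\mathbb Z_p$ containing $m$ that shrink to $\{m\}$, and volumes are Haar measures of total mass $1$. Write $\left(\frac{\cdot}{p}\right)$ for the Legendre symbol. Then for every integer $m$ the limit $\alpha_p(m,Q)$ exists, $\alpha_p(m,Q)=\lim_{k\to\infty} r_{p^k}(m,Q)/p^{2k}$, and it is given as follows. Let $m\neq 0$, $m=m_0p^{m_1}$ with $m_1\ge 0$ and $\gcd(m_0,p)=1$. Put $\varepsilon=\left(\frac{-ab_0}{p}\right)$.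 Then $r_{p^k}(m,Q)/p^{2k}=\alpha_p(m,Q)$ for every $k>m_1$, and: 1. If $m_1<b_1$, then $\alpha_p(m,Q)=p^{m_1/2}\left(1+\left(\frac{am_0}{p}\right)\right)$ if $m_1$ is even, and $\alpha_p(m,Q)=0$ if $m_1$ is odd. 2. If $b_1\le m_1<c_1$, then - for $b_1$ even, $\alpha_p(m,Q)=p^{b_1/2}\left(1-\frac1p\varepsilon^{m_1+1}+\left(1-\frac1p\right)\left(\frac{m_1-b_1}{2}+\frac{(-1)^{m_1}-1}{4}+\varepsilon\left(\frac{m_1-b_1}{2}+\frac{1-(-1)^{m_1}}{4}\right)\right)\right)$; - for $b_1$ odd, $\alpha_p(m,Q)=p^{(b_1-1)/2}\left(1+\left(\frac{a}{p}\right)^{m_1+1}\left(\frac{b_0}{p}\right)^{m_1}\left(\frac{m_0}{p}\right)\right)$. 3. If $m_1\ge c_1$ and $b_1$ is even, then $\alpha_p(m,Q)$ equals - for $c_1$, $m_1$ even: $p^{b_1/2}\left(1+\frac1p+p^{-m_1/2+c_1/2-1}\left(\left(\frac{-ab_0c_0m_0}{p}\right)-1\right)+\left(1-\frac1p\right)\left(\frac{c_1-b_1}{2}+\varepsilon\frac{c_1-b_1}{2}\right)\right)$;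 - for $c_1$ even, $m_1$ odd: $p^{b_1/2}\left(\left(1+\frac1p\right)\left(1-p^{-(m_1+1)/2+c_1/2}\right)+\left(1-\frac1p\right)\left(\frac{c_1-b_1}{2}+\varepsilon\frac{c_1-b_1}{2}\right)\right)$; - for $c_1$ odd, $m_1$ even: $p^{b_1/2}\left(1-p^{-m_1/2+(c_1-1)/2}\varepsilon\left(1+\frac1p\right)+\frac1p\varepsilon+\left(1-\frac1p\right)\left(\frac{c_1-b_1-1}{2}+\varepsilon\frac{c_1-b_1+1}{2}\right)\right)$; - for $c_1$, $m_1$ odd: $p^{b_1/2}\left(1+p^{-(m_1+1)/2+(c_1-1)/2}\left(\left(\frac{c_0m_0}{p}\right)-\varepsilon\right)+\frac1p\varepsilon+\left(1-\frac1p\right)\left(\frac{c_1-b_1-1}{2}+\varepsilon\frac{c_1-b_1+1}{2}\right)\right)$. 4. If $m_1\ge c_1$ and $b_1$ is odd, then $\alpha_p(m,Q)$ equals - for $c_1$, $m_1$ even: $p^{(b_1-1)/2}\left(1+\left(\frac{-ac_0}{p}\right)-p^{-m_1/2+c_1/2}\left(1+\frac1p\right)\left(\frac{-ac_0}{p}\right)\right)$;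 - for $c_1$ even, $m_1$ odd: $p^{(b_1-1)/2}\left(1+\left(\frac{-ac_0}{p}\right)+p^{-(m_1+1)/2+c_1/2}\left(\left(\frac{b_0m_0}{p}\right)-\left(\frac{-ac_0}{p}\right)\right)\right)$; - for $c_1$ odd, $m_1$ even: $p^{(b_1-1)/2}\left(1+\left(\frac{-b_0c_0}{p}\right)+p^{-m_1/2+(c_1-1)/2}\left(\left(\frac{am_0}{p}\right)-\left(\frac{-b_0c_0}{p}\right)\right)\right)$; - for $c_1$, $m_1$ odd: $p^{(b_1-1)/2}\left(1+\left(\frac{-b_0c_0}{p}\right)-p^{(-m_1+c_1)/2}\left(1+\frac1p\right)\left(\frac{-b_0c_0}{p}\right)\right)$. Furthermore, $\alpha_p(0,Q)$ equals - for $b_1$, $c_1$ even: $p^{b_1/2}\left(1+\frac1p+\left(1-\frac1p\right)\left(\frac{c_1-b_1}{2}+\varepsilon\frac{c_1-b_1}{2}\right)\right)$; - for $b_1$ even, $c_1$ odd: $p^{b_1/2}\left(1+\frac1p\varepsilon+\left(1-\frac1p\right)\left(\frac{c_1-b_1-1}{2}+\varepsilon\frac{c_1-b_1+1}{2}\right)\right)$;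 - for $b_1$ odd, $c_1$ even: $p^{(b_1-1)/2}\left(1+\left(\frac{-ac_0}{p}\right)\right)$; - for $b_1$, $c_1$ odd: $p^{(b_1-1)/2}\left(1+\left(\frac{-b_0c_0}{p}\right)\right)$. -/

import Mathlib

open MeasureTheory Filter Topology

noncomputable section

/-- The diagonal ternary form `Q(x, y, z) = a x² + b y² + c z²` with integer coefficients, evaluated
on triples from any commutative ring. -/
def ternaryForm {R : Type*} [CommRing R] (a b c : ℤ) (v : Fin 3 → R) : R :=
  (a : R) * v 0 ^ 2 + (b : R) * v 1 ^ 2 + (c : R) * v 2 ^ 2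

/-- The local representation number `r_n(m, Q)`: the number of `v ∈ (ℤ/nℤ)³` with
`Q(v) = m` in `ℤ/nℤ`. -/
def localRepNumber (n : ℕ) (a b c m : ℤ) : ℕ :=
  Nat.card {v : Fin 3 → ZMod n // ternaryForm a b c v = (m : ZMod n)}

/-- The Borel sigma-algebra on the `p`-adic integers. -/
instance padicIntMeasurableSpace (p : ℕ) [Fact p.Prime] : MeasurableSpace ℤ_[p] :=
  borel ℤ_[p]

instance padicIntBorelSpace (p : ℕ) [Fact p.Prime] : BorelSpace ℤ_[p] := ⟨rfl⟩

/-- The Haar measure on the additive group `ℤ_p` with total mass `1`. -/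
def padicVol (p : ℕ) [Fact p.Prime] : Measure ℤ_[p] :=
  Measure.addHaarMeasure (⊤ : TopologicalSpace.PositiveCompacts ℤ_[p])

/-- The corresponding (product) measure on `ℤ_p³`. -/
def padicVol3 (p : ℕ) [Fact p.Prime] : Measure (Fin 3 → ℤ_[p]) :=
  Measure.pi fun _ => padicVol p

/-- `HasLocalDensity p a b c m α` says that the local density
`α_p(m, Q) = lim_{U → {m}} Vol(Q⁻¹(U)) / Vol(U)` exists and equals `α`, where
`U` runs over the open sets of `ℤ_p` containing `m` and shrinks to `{m}`. -/
def HasLocalDensity (p : ℕ) [Fact p.Prime] (a b c m : ℤ) (α : ℝ) : Prop :=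
  Tendsto
    (fun U : Set ℤ_[p] =>
      (padicVol3 p (ternaryForm a b c ⁻¹' U)).toReal / (padicVol p U).toReal)
    ((𝓝 (m : ℤ_[p])).smallSets ⊓ 𝓟 {U : Set ℤ_[p] | IsOpen U ∧ (m : ℤ_[p]) ∈ U})
    (𝓝 α)

/-- The Legendre symbol `(n / p)` as a real number. -/
def legR (p : ℕ) [Fact p.Prime] (n : ℤ) : ℝ := (legendreSym p n : ℝ)

/-- The closed formula for `α_p(m, Q)` when `m = m₀ p^{m₁} ≠ 0`, `b = b₀ p^{b₁}`, `c = c₀ p^{c₁}`.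
All powers of `p` are real powers. -/
def densityFormula (p : ℕ) [Fact p.Prime] (a b₀ c₀ m₀ : ℤ) (b₁ c₁ m₁ : ℕ) : ℝ :=
  if m₁ < b₁ then
    if Even m₁ then (p : ℝ) ^ ((m₁ : ℝ) / 2) * (1 + legR p (a * m₀))
    else 0
  else if m₁ < c₁ then
    if Even b₁ then
      (p : ℝ) ^ ((b₁ : ℝ) / 2) *
        (1 - 1 / (p : ℝ) * legR p (-a * b₀) ^ (m₁ + 1)
          + (1 - 1 / (p : ℝ)) *
            (((m₁ : ℝ) - b₁) / 2 + ((-1 : ℝ) ^ m₁ - 1) / 4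
              + legR p (-a * b₀) * (((m₁ : ℝ) - b₁) / 2 + (1 - (-1 : ℝ) ^ m₁) / 4)))
    else
      (p : ℝ) ^ (((b₁ : ℝ) - 1) / 2) *
        (1 + legR p a ^ (m₁ + 1) * legR p b₀ ^ m₁ * legR p m₀)
  else if Even b₁ then
    if Even c₁ then
      if Even m₁ then
        (p : ℝ) ^ ((b₁ : ℝ) / 2) *
          (1 + 1 / (p : ℝ)
            + (p : ℝ) ^ (-(m₁ : ℝ) / 2 + (c₁ : ℝ) / 2 - 1) * (legR p (-a * b₀ * c₀ * m₀) - 1)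
            + (1 - 1 / (p : ℝ)) *
              (((c₁ : ℝ) - b₁) / 2 + legR p (-a * b₀) * (((c₁ : ℝ) - b₁) / 2)))
      else
        (p : ℝ) ^ ((b₁ : ℝ) / 2) *
          ((1 + 1 / (p : ℝ)) * (1 - (p : ℝ) ^ (-((m₁ : ℝ) + 1) / 2 + (c₁ : ℝ) / 2))
            + (1 - 1 / (p : ℝ)) *
              (((c₁ : ℝ) - b₁) / 2 + legR p (-a * b₀) * (((c₁ : ℝ) - b₁) / 2)))
    else
      if Even m₁ then
        (p : ℝ) ^ ((b₁ : ℝ) / 2) *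
          (1 - (p : ℝ) ^ (-(m₁ : ℝ) / 2 + ((c₁ : ℝ) - 1) / 2) * legR p (-a * b₀) * (1 + 1 / (p : ℝ))
            + 1 / (p : ℝ) * legR p (-a * b₀)
            + (1 - 1 / (p : ℝ)) *
              (((c₁ : ℝ) - b₁ - 1) / 2 + legR p (-a * b₀) * (((c₁ : ℝ) - b₁ + 1) / 2)))
      else
        (p : ℝ) ^ ((b₁ : ℝ) / 2) *
          (1 + (p : ℝ) ^ (-((m₁ : ℝ) + 1) / 2 + ((c₁ : ℝ) - 1) / 2) *
              (legR p (c₀ * m₀) - legR p (-a * b₀))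
            + 1 / (p : ℝ) * legR p (-a * b₀)
            + (1 - 1 / (p : ℝ)) *
              (((c₁ : ℝ) - b₁ - 1) / 2 + legR p (-a * b₀) * (((c₁ : ℝ) - b₁ + 1) / 2)))
  else
    if Even c₁ then
      if Even m₁ then
        (p : ℝ) ^ (((b₁ : ℝ) - 1) / 2) *
          (1 + legR p (-a * c₀)
            - (p : ℝ) ^ (-(m₁ : ℝ) / 2 + (c₁ : ℝ) / 2) * (1 + 1 / (p : ℝ)) * legR p (-a * c₀))
      else
        (p : ℝ) ^ (((b₁ : ℝ) - 1) / 2) *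
          (1 + legR p (-a * c₀)
            + (p : ℝ) ^ (-((m₁ : ℝ) + 1) / 2 + (c₁ : ℝ) / 2) *
              (legR p (b₀ * m₀) - legR p (-a * c₀)))
    else
      if Even m₁ then
        (p : ℝ) ^ (((b₁ : ℝ) - 1) / 2) *
          (1 + legR p (-b₀ * c₀)
            + (p : ℝ) ^ (-(m₁ : ℝ) / 2 + ((c₁ : ℝ) - 1) / 2) *
              (legR p (a * m₀) - legR p (-b₀ * c₀)))
      else
        (p : ℝ) ^ (((b₁ : ℝ) - 1) / 2) *
          (1 + legR p (-b₀ * c₀)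
            - (p : ℝ) ^ ((-(m₁ : ℝ) + c₁) / 2) * (1 + 1 / (p : ℝ)) * legR p (-b₀ * c₀))

/-- The closed formula for `α_p(0, Q)`. -/
def densityFormulaZero (p : ℕ) [Fact p.Prime] (a b₀ c₀ : ℤ) (b₁ c₁ : ℕ) : ℝ :=
  if Even b₁ then
    if Even c₁ then
      (p : ℝ) ^ ((b₁ : ℝ) / 2) *
        (1 + 1 / (p : ℝ)
          + (1 - 1 / (p : ℝ)) *
            (((c₁ : ℝ) - b₁) / 2 + legR p (-a * b₀) * (((c₁ : ℝ) - b₁) / 2)))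
    else
      (p : ℝ) ^ ((b₁ : ℝ) / 2) *
        (1 + 1 / (p : ℝ) * legR p (-a * b₀)
          + (1 - 1 / (p : ℝ)) *
            (((c₁ : ℝ) - b₁ - 1) / 2 + legR p (-a * b₀) * (((c₁ : ℝ) - b₁ + 1) / 2)))
  else
    if Even c₁ then (p : ℝ) ^ (((b₁ : ℝ) - 1) / 2) * (1 + legR p (-a * c₀))
    else (p : ℝ) ^ (((b₁ : ℝ) - 1) / 2) * (1 + legR p (-b₀ * c₀))

end

/-! Everything is read off from the normalised counts `levelDensity p k` = r_{p^k}(m)/p^{2k}, for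
which one congruence step yields recursions. Split the solutions according to whether a variable
with unit coefficient is prime to p. If x is a unit, Hensel's lemma says that the number of roots of
ax² + s ≡ 0 mod p^{k+1} depends only on s mod p, so this part is a character sum over the residue
field (`boxDensity_peel`). If p ∣ x, substituting px multiplies that coefficient by p². Once every
unit coefficient has been peeled, all coefficients are divisible by p: for p ∤ m no solutions
remain, and for p ∣ m the congruence can be divided by p, which lowers k by one.

With one, two or three unit coefficients this gives affine recursions relating m·p to m. The closed
formula obeys the same recursions and initial values, so for m ≠ 0 the counts equal it as soon as k
> m₁ (`levelDensity_eq_densityFormula`). At m = 0 the descent never ends. For the forms (unit, unit,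
unit) and (unit, unit, p·unit), however, two steps return to the same form with factor 1/p; this
contraction forces convergence to its fixed point, uniformly for m close to 0
(`hasZeroLimit_of_contraction`), and the other exponents reduce to these two.

For the volumes, an open U is an increasing union of sets of full residue classes mod p^k. On each
class t the ratio of volumes is the level density at t, so Vol(Q⁻¹(U))/Vol(U) is a limit of averages
of level densities near m (`abs_padicVol3_sub_le`). These are constant near m ≠ 0 and uniformly
close to the limit near 0. -/

noncomputable section

/-! ### Averages over intervals, root counts and quadratic character sums. -/

section

/-- The average of `f` over `{0, …, N - 1}`. -/
def intervalAvg (N : ℕ) (f : ℤ → ℝ) : ℝ := (∑ x ∈ Finset.range N, f x) / N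

theorem sum_range_mul_eq_sum_sum {M : Type*} [AddCommMonoid M] (m n : ℕ) (f : ℕ → M) :
    ∑ i ∈ Finset.range (m * n), f i
      = ∑ i ∈ Finset.range m, ∑ j ∈ Finset.range n, f (j + n * i) := by
  induction m with
  | zero => simp
  | succ m ih =>
    rw [Nat.succ_mul, Finset.sum_range_add, ih, Finset.sum_range_succ]
    congr 1
    exact Finset.sum_congr rfl fun j _ => by rw [add_comm, mul_comm]

theorem intervalAvg_congr {N : ℕ} {f g : ℤ → ℝ} (h : ∀ x, f x = g x) :
    intervalAvg N f = intervalAvg N g := by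
  rw [funext h]

theorem intervalAvg_const {N : ℕ} (hN : N ≠ 0) (t : ℝ) : intervalAvg N (fun _ => t) = t := by
  have : (N : ℝ) ≠ 0 := by exact_mod_cast hN
  simp [intervalAvg, this]

theorem intervalAvg_add (N : ℕ) (f g : ℤ → ℝ) :
    intervalAvg N (fun x => f x + g x) = intervalAvg N f + intervalAvg N g := by
  simp [intervalAvg, Finset.sum_add_distrib, add_div]

theorem intervalAvg_sub (N : ℕ) (f g : ℤ → ℝ) :
    intervalAvg N (fun x => f x - g x) = intervalAvg N f - intervalAvg N g := by
  simp [intervalAvg, Finset.sum_sub_distrib, sub_div]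

theorem intervalAvg_const_mul (N : ℕ) (t : ℝ) (f : ℤ → ℝ) :
    intervalAvg N (fun x => t * f x) = t * intervalAvg N f := by
  simp only [intervalAvg, ← Finset.mul_sum, mul_div_assoc]

theorem intervalAvg_comm (M N : ℕ) (f : ℤ → ℤ → ℝ) :
    intervalAvg M (fun x => intervalAvg N fun y => f x y)
      = intervalAvg N fun y => intervalAvg M fun x => f x y := by
  simp only [intervalAvg, ← Finset.sum_div]
  rw [Finset.sum_comm, div_right_comm]

theorem intervalAvg_mul_of_periodic {M N : ℕ} (hM : M ≠ 0) {f : ℤ → ℝ}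
    (hf : ∀ x i : ℤ, f (x + N * i) = f x) : intervalAvg (M * N) f = intervalAvg N f := by
  have : (M : ℝ) ≠ 0 := by exact_mod_cast hM
  simp only [intervalAvg]
  rw [sum_range_mul_eq_sum_sum]
  simp only [Nat.cast_add, Nat.cast_mul, hf, Finset.sum_const, Finset.card_range, nsmul_eq_mul]
  rw [mul_div_mul_left _ _ this]

theorem intervalAvg_pow_eq_of_periodic {p k K : ℕ} (hp : p ≠ 0) (hk : k ≤ K) {f : ℤ → ℝ}
    (hf : ∀ x i : ℤ, f (x + (p : ℤ) ^ k * i) = f x) :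
    intervalAvg (p ^ K) f = intervalAvg (p ^ k) f := by
  obtain ⟨j, rfl⟩ := Nat.exists_eq_add_of_le' hk
  rw [pow_add]
  exact intervalAvg_mul_of_periodic (pow_ne_zero _ hp) (by simpa using hf)

theorem intervalAvg_pow_succ (p k : ℕ) (f : ℤ → ℝ) :
    intervalAvg (p ^ (k + 1)) f
      = (∑ r ∈ Finset.range p, intervalAvg (p ^ k) fun x => f (r + p * x)) / p := by
  simp only [intervalAvg, ← Finset.sum_div]
  rw [pow_succ, sum_range_mul_eq_sum_sum, Finset.sum_comm, div_div]
  simp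

theorem intervalAvg_multiples {p : ℕ} (hp : p ≠ 0) (k : ℕ) (f : ℤ → ℝ) :
    intervalAvg (p ^ (k + 1)) (fun x => if (p : ℤ) ∣ x then f x else 0)
      = 1 / p * intervalAvg (p ^ k) fun x => f (p * x) := by
  rw [intervalAvg_pow_succ, Finset.sum_eq_single 0]
  · simp; ring
  · intro r hr h0
    have : ¬ (p : ℤ) ∣ r := by
      rw [Int.natCast_dvd_natCast]
      exact fun h => h0 (Nat.eq_zero_of_dvd_of_lt h (Finset.mem_range.1 hr))
    simp [intervalAvg, Int.dvd_add_left (dvd_mul_right (p : ℤ) _), this]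
  · simp [Nat.pos_of_ne_zero hp]

theorem intervalAvg_eq_sum_of_periodic {p k : ℕ} (hp : p ≠ 0) (hk : 1 ≤ k) {f : ℤ → ℝ}
    (hf : ∀ x i : ℤ, f (x + p * i) = f x) :
    intervalAvg (p ^ k) f = (∑ r ∈ Finset.range p, f r) / p := by
  rw [intervalAvg_pow_eq_of_periodic hp hk (by simpa using hf), pow_one, intervalAvg]

theorem sum_range_eq_sum_zmod {M : Type*} [AddCommMonoid M] (n : ℕ) [NeZero n] (f : ZMod n → M) :
    ∑ x ∈ Finset.range n, f (x : ZMod n) = ∑ x : ZMod n, f x := by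
  refine Finset.sum_bij (fun x _ => (x : ZMod n)) (by simp) ?_ ?_ (by simp)
  · intro a ha b hb h
    rw [ZMod.natCast_eq_natCast_iff] at h
    exact Nat.ModEq.eq_of_lt_of_lt h (Finset.mem_range.1 ha) (Finset.mem_range.1 hb)
  · exact fun b _ => ⟨b.val, by simp [ZMod.val_lt], by simp⟩

/-- The difference of two values is (u + p·(…))(x − y) with a unit first factor. Hence the
polynomial permutes ℤ/p^j and vanishes exactly once. -/
theorem sum_range_indicator_root_eq_one (p : ℕ) [Fact p.Prime] (j : ℕ) {u : ℤ} (hu : ¬ (p : ℤ) ∣ u)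
    (s e : ℤ) :
    ∑ x ∈ Finset.range (p ^ j),
      (if (p : ℤ) ^ j ∣ s + u * x + p * e * (x : ℤ) ^ 2 then (1 : ℝ) else 0) = 1 := by
  have hp : p.Prime := Fact.out
  have : NeZero (p ^ j) := ⟨pow_ne_zero _ hp.ne_zero⟩
  have key : ∀ x : ℕ, ((p : ℤ) ^ j ∣ s + u * x + p * e * (x : ℤ) ^ 2) ↔
      (s + u * (x : ZMod (p ^ j)) + p * e * (x : ZMod (p ^ j)) ^ 2 = 0) := by
    intro x
    have := ZMod.intCast_zmod_eq_zero_iff_dvd (s + u * x + p * e * (x : ℤ) ^ 2) (p ^ j)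
    push_cast at this
    rw [← this]
  have hinj : Function.Injective
      (fun x : ZMod (p ^ j) => (s : ZMod (p ^ j)) + u * x + p * e * x ^ 2) := by
    intro x y hxy
    obtain ⟨x, rfl⟩ := ZMod.intCast_surjective x
    obtain ⟨y, rfl⟩ := ZMod.intCast_surjective y
    have h : ((p ^ j : ℕ) : ℤ) ∣ (s + u * x + p * e * x ^ 2) - (s + u * y + p * e * y ^ 2) := by
      rw [← ZMod.intCast_zmod_eq_zero_iff_dvd]
      push_cast
      exact sub_eq_zero.2 hxy
    have h2 : (s + u * x + p * e * x ^ 2) - (s + u * y + p * e * y ^ 2)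
      = (u + p * (e * (x + y))) * (x - y) := by ring
    rw [h2] at h
    have hc : IsCoprime ((p ^ j : ℕ) : ℤ) (u + p * (e * (x + y))) := by
      push_cast
      refine IsCoprime.pow_left ((Nat.prime_iff_prime_int.1 hp).coprime_iff_not_dvd.2 ?_)
      rwa [Int.dvd_add_left (dvd_mul_right _ _)]
    have := hc.dvd_of_dvd_mul_left h
    rw [← sub_eq_zero, ← Int.cast_sub, ZMod.intCast_zmod_eq_zero_iff_dvd]
    exact this
  have hbij := Finite.injective_iff_bijective.1 hinj
  simp only [key]
  rw [sum_range_eq_sum_zmod (p ^ j)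
    (fun x => if (s + u * x + p * e * x ^ 2 : ZMod (p ^ j)) = 0 then (1 : ℝ) else 0)]
  exact (Function.Bijective.sum_comp hbij (fun t : ZMod (p ^ j) => if t = 0 then (1 : ℝ) else 0)).trans
    (by simp)

theorem legR_congr {p : ℕ} [Fact p.Prime] {s t : ℤ} (h : (s : ZMod p) = t) :
    legR p s = legR p t := by
  simp [legR, legendreSym, h]

theorem legR_mul (p : ℕ) [Fact p.Prime] (s t : ℤ) : legR p (s * t) = legR p s * legR p t := by
  simp [legR, legendreSym.mul]

theorem legR_eq_zero {p : ℕ} [Fact p.Prime] {s : ℤ} (h : (p : ℤ) ∣ s) : legR p s = 0 := by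
  rw [legR, (legendreSym.eq_zero_iff p s).2 ((ZMod.intCast_zmod_eq_zero_iff_dvd s p).2 h),
    Int.cast_zero]

theorem legR_mul_self {p : ℕ} [Fact p.Prime] {s : ℤ} (h : ¬ (p : ℤ) ∣ s) :
    legR p s * legR p s = 1 := by
  have := legendreSym.sq_one p (a := s) (by rwa [Ne, ZMod.intCast_zmod_eq_zero_iff_dvd])
  rw [legR, ← sq]
  exact_mod_cast this

/-- The number of residues `r` mod `p` with `a r² ≡ t`, as a sum over representatives. -/
theorem sum_range_indicator_sq {p : ℕ} [Fact p.Prime] (hp : p ≠ 2) {a : ℤ} (ha : ¬ (p : ℤ) ∣ a)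
    (t : ℤ) :
    ∑ r ∈ Finset.range p, (if (p : ℤ) ∣ a * (r : ℤ) ^ 2 - t then (1 : ℝ) else 0)
      = 1 + legR p (a * t) := by
  have ha' : (a : ZMod p) ≠ 0 := by rwa [Ne, ZMod.intCast_zmod_eq_zero_iff_dvd]
  have key : ∀ x : ℕ, ((p : ℤ) ∣ a * (x : ℤ) ^ 2 - t) ↔
      (a * (x : ZMod p) ^ 2 - t = 0) := by
    intro x
    have := ZMod.intCast_zmod_eq_zero_iff_dvd (a * (x : ℤ) ^ 2 - t) p
    push_cast at this
    rw [← this]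
  simp only [key]
  rw [sum_range_eq_sum_zmod p (fun x => if (a * x ^ 2 - t : ZMod p) = 0 then (1 : ℝ) else 0)]
  have hcard := legendreSym.card_sqrts p hp (a * t)
  have h2 : ∑ x : ZMod p, (if (a * x ^ 2 - t : ZMod p) = 0 then (1 : ℝ) else 0)
      = ∑ x : ZMod p, (if x ^ 2 = ((a * t : ℤ) : ZMod p) then (1 : ℝ) else 0) := by
    -- Multiplying by a turns ax² = t into (ax)² = at.
    refine Fintype.sum_equiv (Equiv.mulLeft₀ (a : ZMod p) ha') _ _ fun x => ?_
    congr 1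
    change _ = (((a : ZMod p) * x) ^ 2 = _)
    simp only [Int.cast_mul, eq_iff_iff]
    rw [mul_pow, sq (a : ZMod p), mul_assoc, mul_right_inj' ha', sub_eq_zero]
  rw [h2, Finset.sum_boole, legR, add_comm (1 : ℝ)]
  rw [Set.toFinset_ofPred] at hcard
  exact_mod_cast hcard

/-- Each t is a square y² in χ(t) + 1 ways, which reduces the sum to one over t. The term linear in
t sums to zero. In the other, (α + βt)t = t²(β + α/t), so s = 1/t makes it linear too, apart from
the missing point s = 0, which accounts for −χ(β). -/
theorem sum_quadraticChar_add_mul_sq {F : Type*} [Field F] [Fintype F] [DecidableEq F]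
    (hF : ringChar F ≠ 2) (α : F) {β : F} (hβ : β ≠ 0) :
    ∑ y : F, quadraticChar F (α + β * y ^ 2)
      = quadraticChar F β * (Fintype.card F * (if α = 0 then 1 else 0) - 1) := by
  set χ := quadraticChar F with hχ
  have h0 : ∑ t : F, χ t = 0 := quadraticChar_sum_zero hF
  have h1 : ∑ y : F, χ (α + β * y ^ 2) = ∑ t : F, χ (α + β * t) * (χ t + 1) := by
    have : ∀ t : F, χ (α + β * t) * (χ t + 1)
        = ∑ y : F, if y ^ 2 = t then χ (α + β * t) else 0 := by
      intro t
      rw [← quadraticChar_card_sqrts hF t, ← Finset.sum_filter, Finset.sum_const, Set.toFinset_ofPred,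
        nsmul_eq_mul, mul_comm]
    simp only [this]
    rw [Finset.sum_comm]
    simp
  have h2 : ∑ t : F, χ (α + β * t) = 0 := by
    rw [← h0]
    exact Fintype.sum_equiv ((Equiv.mulLeft₀ β hβ).trans (Equiv.addLeft α)) _ _ fun _ => rfl
  have h3 : ∑ t : F, χ (α + β * t) * χ t
      = ∑ s : F, if s = 0 then 0 else χ (β + α * s) := by
    refine Fintype.sum_equiv (Equiv.inv F) _ _ fun t => ?_
    by_cases ht : t = 0
    · simp [ht, hχ]
    · have : β + α * t⁻¹ = (α + β * t) * t * t⁻¹ ^ 2 := by field_simp; ring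
      simp only [Equiv.inv_apply, inv_eq_zero, ht, if_false]
      rw [this, map_mul, map_mul, map_pow, quadraticChar_sq_one (inv_ne_zero ht), mul_one]
  have h4 : ∑ s : F, (if s = 0 then 0 else χ (β + α * s)) = ∑ s : F, χ (β + α * s) - χ β := by
    rw [← Finset.sum_erase_add _ _ (Finset.mem_univ (0 : F)),
      ← Finset.sum_erase_add _ (fun s => χ (β + α * s)) (Finset.mem_univ (0 : F))]
    simp only [if_true, mul_zero, add_zero, add_sub_cancel_right]
    exact Finset.sum_congr rfl fun s hs => by simp [Finset.ne_of_mem_erase hs]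
  rw [h1]
  simp only [mul_add, mul_one]
  rw [Finset.sum_add_distrib, h2, h3, h4, add_zero]
  by_cases hα : α = 0
  · simp [hα]; ring
  · have : ∑ s : F, χ (β + α * s) = 0 := by
      rw [← h0]
      exact Fintype.sum_equiv ((Equiv.mulLeft₀ α hα).trans (Equiv.addLeft β)) _ _ fun _ => rfl
    simp [hα, this]

theorem sum_range_legR_quadratic {p : ℕ} [Fact p.Prime] (hp : p ≠ 2) (α : ℤ) {β : ℤ}
    (hβ : ¬ (p : ℤ) ∣ β) :
    ∑ y ∈ Finset.range p, legR p (α + β * (y : ℤ) ^ 2)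
      = legR p β * (p * (if (p : ℤ) ∣ α then 1 else 0) - 1) := by
  have hβ' : (β : ZMod p) ≠ 0 := by rwa [Ne, ZMod.intCast_zmod_eq_zero_iff_dvd]
  have h := sum_quadraticChar_add_mul_sq (by rwa [ZMod.ringChar_zmod_n]) (α : ZMod p) hβ'
  rw [ZMod.card, ← sum_range_eq_sum_zmod] at h
  simp only [legR, legendreSym, ← ZMod.intCast_zmod_eq_zero_iff_dvd]
  push_cast
  exact_mod_cast h

end

/-! ### Densities on boxes, and peeling off the unit values of a variable. -/

section

/-- The density of solutions of `a x² + b y² + c z² ≡ m (mod p^k)` among the integer points of the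
box `[0, p^K₀) × [0, p^K₁) × [0, p^K₂)`, scaled by `p^k`. -/
def boxDensity (p k K₀ K₁ K₂ : ℕ) (a b c m : ℤ) : ℝ :=
  (p : ℝ) ^ k * intervalAvg (p ^ K₀) fun x => intervalAvg (p ^ K₁) fun y =>
    intervalAvg (p ^ K₂) fun z =>
      if (p : ℤ) ^ k ∣ a * x ^ 2 + b * y ^ 2 + c * z ^ 2 - m then 1 else 0

/-- The weight contributed by the solutions of `a x² + s ≡ 0` with `x` prime to `p`. -/
def unitWeight (p : ℕ) [Fact p.Prime] (a s : ℤ) : ℝ :=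
  1 + legR p (-a * s) - if (p : ℤ) ∣ s then 1 else 0

theorem boxDensity_swap (p k K₀ K₁ K₂ : ℕ) (a b c m : ℤ) :
    boxDensity p k K₀ K₁ K₂ a b c m = boxDensity p k K₁ K₀ K₂ b a c m := by
  rw [boxDensity, intervalAvg_comm, boxDensity]
  simp only [add_comm]

theorem boxDensity_swap_right (p k K₀ K₁ K₂ : ℕ) (a b c m : ℤ) :
    boxDensity p k K₀ K₁ K₂ a b c m = boxDensity p k K₀ K₂ K₁ a c b m := by
  simp only [boxDensity]
  congr 2
  funext x
  rw [intervalAvg_comm]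
  simp only [add_right_comm]

theorem pow_dvd_add_mul_sq_iff {p k : ℕ} (a x i s : ℤ) :
    (p : ℤ) ^ k ∣ a * (x + (p : ℤ) ^ k * i) ^ 2 + s ↔ (p : ℤ) ^ k ∣ a * x ^ 2 + s := by
  rw [show a * (x + (p : ℤ) ^ k * i) ^ 2 + s
    = (a * x ^ 2 + s) + (p : ℤ) ^ k * (a * (2 * x * i + (p : ℤ) ^ k * i ^ 2)) by ring]
  exact dvd_add_left (dvd_mul_right _ _)

theorem boxDensity_level_zero {p k K₀ : ℕ} (hp : p ≠ 0) (hk : k ≤ K₀) (K₁ K₂ : ℕ) (a b c m : ℤ) :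
    boxDensity p k K₀ K₁ K₂ a b c m = boxDensity p k k K₁ K₂ a b c m := by
  rw [boxDensity, intervalAvg_pow_eq_of_periodic hp hk, boxDensity]
  intro x i
  refine intervalAvg_congr fun y => intervalAvg_congr fun z => ?_
  have := pow_dvd_add_mul_sq_iff (p := p) (k := k) a x i (b * y ^ 2 + c * z ^ 2 - m)
  simp only [← add_sub_assoc, ← add_assoc] at this
  simp only [this]

/-- `p^k` times the proportion of solutions mod `p^k` of `a x² + b y² + c z² ≡ m`. -/
def levelDensity (p k : ℕ) (a b c m : ℤ) : ℝ := boxDensity p k k k k a b c m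

/-- Peeling shortens sides of the box, and division by p lowers the level, so the exponents get out
of step. Since the congruence is periodic mod p^k in each variable, any side with exponent at least
k may be cut to k. -/
theorem boxDensity_eq_levelDensity {p k K₀ K₁ K₂ : ℕ} (hp : p ≠ 0) (h₀ : k ≤ K₀) (h₁ : k ≤ K₁)
    (h₂ : k ≤ K₂) (a b c m : ℤ) :
    boxDensity p k K₀ K₁ K₂ a b c m = levelDensity p k a b c m := by
  rw [boxDensity_level_zero hp h₀, boxDensity_swap, boxDensity_level_zero hp h₁,
    boxDensity_swap_right, boxDensity_swap, boxDensity_level_zero hp h₂, boxDensity_swap,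
    boxDensity_swap_right, boxDensity_swap, levelDensity]

theorem levelDensity_swap (p k : ℕ) (a b c m : ℤ) :
    levelDensity p k a b c m = levelDensity p k b a c m :=
  boxDensity_swap ..

theorem levelDensity_swap_right (p k : ℕ) (a b c m : ℤ) :
    levelDensity p k a b c m = levelDensity p k a c b m :=
  boxDensity_swap_right ..

theorem levelDensity_zero (p : ℕ) (a b c m : ℤ) : levelDensity p 0 a b c m = 1 := by
  simp [levelDensity, boxDensity, intervalAvg]

theorem boxDensity_mul_left {p k : ℕ} (hp : p ≠ 0) (K₀ K₁ K₂ : ℕ) (a b c m : ℤ) :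
    boxDensity p (k + 1) K₀ K₁ K₂ (p * a) (p * b) (p * c) (p * m)
      = p * boxDensity p k K₀ K₁ K₂ a b c m := by
  have : ∀ x y z : ℤ, (p : ℤ) ^ (k + 1) ∣ p * a * x ^ 2 + p * b * y ^ 2 + p * c * z ^ 2 - p * m ↔
      (p : ℤ) ^ k ∣ a * x ^ 2 + b * y ^ 2 + c * z ^ 2 - m := by
    intro x y z
    rw [pow_succ', show p * a * x ^ 2 + p * b * y ^ 2 + p * c * z ^ 2 - p * m
      = p * (a * x ^ 2 + b * y ^ 2 + c * z ^ 2 - m) by ring]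
    exact mul_dvd_mul_iff_left (by exact_mod_cast hp)
  simp only [boxDensity, this]
  rw [pow_succ', mul_assoc]

theorem boxDensity_mul_left_of_not_dvd {p k : ℕ} (hk : 1 ≤ k) (K₀ K₁ K₂ : ℕ) (a b c : ℤ) {m : ℤ}
    (hm : ¬ (p : ℤ) ∣ m) : boxDensity p k K₀ K₁ K₂ (p * a) (p * b) (p * c) m = 0 := by
  have : ∀ x y z : ℤ, ¬ (p : ℤ) ^ k ∣ p * a * x ^ 2 + p * b * y ^ 2 + p * c * z ^ 2 - m := by
    intro x y z h
    have h1 := (dvd_pow_self (p : ℤ) (by omega)).trans h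
    rw [show p * a * x ^ 2 + p * b * y ^ 2 + p * c * z ^ 2 - m
      = p * (a * x ^ 2 + b * y ^ 2 + c * z ^ 2) - m by ring,
      dvd_sub_right (dvd_mul_right _ _)] at h1
    exact hm h1
  simp [boxDensity, this, intervalAvg]

variable {p : ℕ} [Fact p.Prime]

theorem unitWeight_congr {a s t : ℤ} (h : (p : ℤ) ∣ s - t) : unitWeight p a s = unitWeight p a t := by
  have h' : ((s : ℤ) : ZMod p) = t := by
    rwa [← sub_eq_zero, ← Int.cast_sub, ZMod.intCast_zmod_eq_zero_iff_dvd]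
  rw [unitWeight, unitWeight, legR_congr (s := -a * s) (t := -a * t) (by push_cast; rw [h'])]
  simp only [← ZMod.intCast_zmod_eq_zero_iff_dvd, h']

theorem not_dvd_two_mul (hp : p ≠ 2) {a : ℤ} (ha : ¬ (p : ℤ) ∣ a) : ¬ (p : ℤ) ∣ 2 * a := by
  have hpp : p.Prime := Fact.out
  rw [(Nat.prime_iff_prime_int.1 hpp).dvd_mul, not_or]
  refine ⟨fun h => hp ?_, ha⟩
  exact (Nat.prime_dvd_prime_iff_eq hpp Nat.prime_two).1 (by exact_mod_cast h)

/-- Hensel's lemma in one variable, as a count. -/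
theorem intervalAvg_unit_root (hp : p ≠ 2) {k : ℕ} {a : ℤ} (ha : ¬ (p : ℤ) ∣ a) (s : ℤ) :
    intervalAvg (p ^ (k + 1))
      (fun x => if (p : ℤ) ∣ x then 0 else if (p : ℤ) ^ (k + 1) ∣ a * x ^ 2 + s then 1 else 0)
      = unitWeight p a s / (p : ℝ) ^ (k + 1) := by
  have hpp : p.Prime := Fact.out
  have hP := Nat.prime_iff_prime_int.1 hpp
  have hp0 : (p : ℝ) ≠ 0 := by exact_mod_cast hpp.ne_zero
  have hp0' : (p : ℤ) ≠ 0 := by exact_mod_cast hpp.ne_zero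
  have key : ∀ r : ℕ, intervalAvg (p ^ k) (fun x => if (p : ℤ) ∣ r + p * x then 0 else
        if (p : ℤ) ^ (k + 1) ∣ a * (r + p * x) ^ 2 + s then 1 else 0)
      = (if (p : ℤ) ∣ r then 0 else if (p : ℤ) ∣ a * (r : ℤ) ^ 2 - (-s) then 1 else 0) / (p : ℝ) ^ k := by
    intro r
    simp only [Int.dvd_add_left (dvd_mul_right (p : ℤ) _), sub_neg_eq_add]
    by_cases hr : (p : ℤ) ∣ r
    · simp [hr, intervalAvg]
    simp only [hr, if_false]
    -- In x = r + px' the linear coefficient 2ar is a unit because p is odd. After division by p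
    -- there is exactly one lift x' mod p^k.
    have hexp : ∀ x : ℤ, a * (r + p * x) ^ 2 + s
        = (a * (r : ℤ) ^ 2 + s) + p * (2 * a * r * x + p * a * x ^ 2) := fun x => by ring
    by_cases hs : (p : ℤ) ∣ a * (r : ℤ) ^ 2 + s
    · obtain ⟨t, ht⟩ := hs
      have : ∀ x : ℤ, (p : ℤ) ^ (k + 1) ∣ a * (r + p * x) ^ 2 + s ↔
          (p : ℤ) ^ k ∣ t + 2 * a * r * x + p * a * x ^ 2 := by
        intro x
        rw [hexp, ht, ← mul_add, pow_succ', mul_dvd_mul_iff_left hp0', add_assoc]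
      have hu : ¬ (p : ℤ) ∣ 2 * a * r := by
        rw [hP.dvd_mul, not_or]
        exact ⟨not_dvd_two_mul hp ha, hr⟩
      simp only [this, ht, dvd_mul_right, if_true, intervalAvg]
      rw [sum_range_indicator_root_eq_one p k hu]
      simp
    · have : ∀ x : ℤ, ¬ (p : ℤ) ^ (k + 1) ∣ a * (r + p * x) ^ 2 + s := by
        intro x h
        have h1 := (dvd_pow_self (p : ℤ) (by omega)).trans h
        rw [hexp, dvd_add_left (dvd_mul_right _ _)] at h1
        exact hs h1
      simp [this, hs, intervalAvg]
  rw [intervalAvg_pow_succ]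
  simp only [key]
  rw [← Finset.sum_div, div_div, ← pow_succ]
  congr 1
  -- Discarding the residue 0 from all the roots mod p loses one root, exactly when p ∣ s.
  have h1 : ∀ r ∈ Finset.range p,
      (if (p : ℤ) ∣ r then 0 else if (p : ℤ) ∣ a * (r : ℤ) ^ 2 - (-s) then (1 : ℝ) else 0)
      = (if (p : ℤ) ∣ a * (r : ℤ) ^ 2 - (-s) then (1 : ℝ) else 0)
        - if r = 0 then (if (p : ℤ) ∣ s then 1 else 0) else 0 := by
    intro r hr
    have : (p : ℤ) ∣ r ↔ r = 0 := by
      rw [Int.natCast_dvd_natCast]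
      exact ⟨fun h => Nat.eq_zero_of_dvd_of_lt h (Finset.mem_range.1 hr), fun h => h ▸ dvd_zero _⟩
    simp only [this]
    split_ifs <;> simp_all
  rw [Finset.sum_congr rfl h1, Finset.sum_sub_distrib, sum_range_indicator_sq hp ha,
    Finset.sum_ite_eq' , if_pos (Finset.mem_range.2 hpp.pos), unitWeight]
  congr 3
  ring_nf

/-- Separating the solutions with `x` prime to `p` from those with `p ∣ x`. -/
theorem boxDensity_peel (hp : p ≠ 2) {a : ℤ} (ha : ¬ (p : ℤ) ∣ a) (k K₁ K₂ : ℕ) (b c m : ℤ) :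
    boxDensity p (k + 1) (k + 1) K₁ K₂ a b c m
      = intervalAvg (p ^ K₁) (fun y => intervalAvg (p ^ K₂) fun z =>
          unitWeight p a (b * y ^ 2 + c * z ^ 2 - m))
        + 1 / p * boxDensity p (k + 1) k K₁ K₂ (p * (p * a)) b c m := by
  have hpp : p.Prime := Fact.out
  have hp0 : (p : ℝ) ≠ 0 := by exact_mod_cast hpp.ne_zero
  set f : ℤ → ℤ → ℤ → ℝ := fun x y z =>
    if (p : ℤ) ^ (k + 1) ∣ a * x ^ 2 + b * y ^ 2 + c * z ^ 2 - m then 1 else 0 with hf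
  have hsplit : boxDensity p (k + 1) (k + 1) K₁ K₂ a b c m
      = (p : ℝ) ^ (k + 1) * (intervalAvg (p ^ (k + 1)) (fun x => intervalAvg (p ^ K₁) fun y =>
          intervalAvg (p ^ K₂) fun z => if (p : ℤ) ∣ x then 0 else f x y z)
        + intervalAvg (p ^ (k + 1)) (fun x => if (p : ℤ) ∣ x then intervalAvg (p ^ K₁) fun y =>
          intervalAvg (p ^ K₂) fun z => f x y z else 0)) := by
    rw [boxDensity, ← intervalAvg_add]
    congr 1
    refine intervalAvg_congr fun x => ?_
    by_cases hx : (p : ℤ) ∣ x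
    · simp [hx, hf, intervalAvg]
    · simp [hx, hf]
  -- The multiples x = px' have x' in an interval shorter by a factor p: hence the 1/p, the exponent
  -- k and the coefficient p²a.
  rw [hsplit, intervalAvg_multiples hpp.ne_zero, intervalAvg_comm, mul_add]
  congr 1
  · rw [← intervalAvg_const_mul]
    refine intervalAvg_congr fun y => ?_
    rw [intervalAvg_comm, ← intervalAvg_const_mul]
    refine intervalAvg_congr fun z => ?_
    have := intervalAvg_unit_root hp (k := k) ha (b * y ^ 2 + c * z ^ 2 - m)
    simp only [← add_sub_assoc, ← add_assoc] at this
    simp only [hf, this]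
    field_simp
  · rw [boxDensity, mul_left_comm]
    congr 2
    refine intervalAvg_congr fun x => intervalAvg_congr fun y => intervalAvg_congr fun z => ?_
    simp only [hf]
    congr 2
    ring_nf

end

/-! ### Recursions for level densities with one, two or three unit coefficients. -/

section

theorem levelDensity_mul_of_not_dvd {p : ℕ} (k : ℕ) (a b c : ℤ) {m : ℤ} (hm : ¬ (p : ℤ) ∣ m) :
    levelDensity p (k + 1) (p * a) (p * b) (p * c) m = 0 :=
  boxDensity_mul_left_of_not_dvd (by omega) _ _ _ _ _ _ hm

variable {p : ℕ} [Fact p.Prime]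

theorem not_dvd_mul {a b : ℤ} (ha : ¬ (p : ℤ) ∣ a) (hb : ¬ (p : ℤ) ∣ b) : ¬ (p : ℤ) ∣ a * b := by
  rw [(Nat.prime_iff_prime_int.1 (Fact.out : p.Prime)).dvd_mul, not_or]
  exact ⟨ha, hb⟩

theorem intervalAvg_indicator_sq (hp : p ≠ 2) {k : ℕ} (hk : 1 ≤ k) {b : ℤ} (hb : ¬ (p : ℤ) ∣ b)
    (s : ℤ) :
    intervalAvg (p ^ k) (fun y => if (p : ℤ) ∣ b * y ^ 2 + s then (1 : ℝ) else 0)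
      = (1 + legR p (-b * s)) / p := by
  have h := sum_range_indicator_sq hp hb (-s)
  simp only [sub_neg_eq_add] at h
  rw [intervalAvg_eq_sum_of_periodic (Fact.out : p.Prime).ne_zero hk, h]
  · congr 3; ring
  · intro y i
    have := pow_dvd_add_mul_sq_iff (p := p) (k := 1) b y i s
    simp only [pow_one] at this
    simp only [this]

theorem intervalAvg_unitWeight (hp : p ≠ 2) {k : ℕ} (hk : 1 ≤ k) {a b : ℤ} (ha : ¬ (p : ℤ) ∣ a)
    (hb : ¬ (p : ℤ) ∣ b) (s : ℤ) :
    intervalAvg (p ^ k) (fun y => unitWeight p a (b * y ^ 2 + s))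
      = 1 + (legR p (-a * b) * (p * (if (p : ℤ) ∣ s then 1 else 0) - 1) - (1 + legR p (-b * s))) / p := by
  have hpp : p.Prime := Fact.out
  have hp0 : (p : ℝ) ≠ 0 := by exact_mod_cast hpp.ne_zero
  have hab : ¬ (p : ℤ) ∣ -a * b := not_dvd_mul (by rwa [dvd_neg]) hb
  have h1 : intervalAvg (p ^ k) (fun y => legR p (-a * (b * y ^ 2 + s)))
      = legR p (-a * b) * (p * (if (p : ℤ) ∣ s then 1 else 0) - 1) / p := by
    rw [intervalAvg_eq_sum_of_periodic hpp.ne_zero hk]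
    · have h := sum_range_legR_quadratic hp (-a * s) hab
      have hs : (p : ℤ) ∣ -a * s ↔ (p : ℤ) ∣ s := by
        rw [neg_mul, dvd_neg, (Nat.prime_iff_prime_int.1 hpp).dvd_mul, or_iff_right ha]
      simp only [hs] at h
      rw [← h]
      congr 1
      refine Finset.sum_congr rfl fun y _ => ?_
      congr 1; ring
    · intro y i
      exact legR_congr (by simp)
  simp only [unitWeight]
  rw [intervalAvg_sub, intervalAvg_add, intervalAvg_const (pow_ne_zero _ hpp.ne_zero), h1,
    intervalAvg_indicator_sq hp hk hb]
  ring

theorem levelDensity_mul (k : ℕ) (a b c m : ℤ) :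
    levelDensity p (k + 1) (p * a) (p * b) (p * c) (p * m) = p * levelDensity p k a b c m := by
  have hp := (Fact.out : p.Prime).ne_zero
  rw [levelDensity, boxDensity_mul_left hp,
    boxDensity_eq_levelDensity hp (by omega) (by omega) (by omega)]

/-- Mod p only ax² − m is visible, so the unit weight does not depend on y and z. -/
theorem levelDensity_one_unit (hp : p ≠ 2) (k : ℕ) {a : ℤ} (ha : ¬ (p : ℤ) ∣ a) (b c m : ℤ) :
    levelDensity p (k + 1) a (p * b) (p * c) m
      = unitWeight p a (-m)
        + 1 / p * boxDensity p (k + 1) k (k + 1) (k + 1) (p * (p * a)) (p * b) (p * c) m := by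
  have hp0 := (Fact.out : p.Prime).ne_zero
  rw [levelDensity, boxDensity_peel hp ha]
  congr 1
  have : ∀ y z : ℤ, unitWeight p a (p * b * y ^ 2 + p * c * z ^ 2 - m) = unitWeight p a (-m) :=
    fun y z => unitWeight_congr ⟨b * y ^ 2 + c * z ^ 2, by ring⟩
  simp only [this, intervalAvg_const (pow_ne_zero _ hp0)]

theorem levelDensity_one_unit_of_not_dvd (hp : p ≠ 2) (k : ℕ) {a : ℤ} (ha : ¬ (p : ℤ) ∣ a)
    (b c : ℤ) {m : ℤ} (hm : ¬ (p : ℤ) ∣ m) :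
    levelDensity p (k + 1) a (p * b) (p * c) m = 1 + legR p (a * m) := by
  rw [levelDensity_one_unit hp k ha, boxDensity_mul_left_of_not_dvd (by omega) _ _ _ _ _ _ hm,
    unitWeight, if_neg (by rwa [dvd_neg]), neg_mul_neg]
  ring

/-- When p divides the value, p ∣ x is forced and the unit weight vanishes. Dividing by p
contributes a factor p, which cancels the 1/p. -/
theorem levelDensity_one_unit_mul (hp : p ≠ 2) (k : ℕ) {a : ℤ} (ha : ¬ (p : ℤ) ∣ a) (b c m : ℤ) :
    levelDensity p (k + 1) a (p * b) (p * c) (p * m) = levelDensity p k (p * a) b c m := by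
  have hpp := (Fact.out : p.Prime).ne_zero
  have hp0 : (p : ℝ) ≠ 0 := by exact_mod_cast hpp
  rw [levelDensity_one_unit hp k ha, boxDensity_mul_left hpp, unitWeight,
    legR_eq_zero ⟨a * m, by ring⟩, if_pos ((dvd_neg).2 (dvd_mul_right _ _)),
    boxDensity_eq_levelDensity hpp (by omega) (by omega) (by omega)]
  field_simp
  ring

/-- Peel x, then y. The symbol of bm occurs in both unit contributions with opposite signs and
cancels. -/
theorem levelDensity_two_units (hp : p ≠ 2) (k : ℕ) {a b : ℤ} (ha : ¬ (p : ℤ) ∣ a)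
    (hb : ¬ (p : ℤ) ∣ b) (c m : ℤ) :
    levelDensity p (k + 1) a b (p * c) m
      = 1 + (legR p (-a * b) * (p * (if (p : ℤ) ∣ m then 1 else 0) - 1)
            - if (p : ℤ) ∣ m then 1 else 0) / p
        + 1 / p * (1 / p * boxDensity p (k + 1) k k (k + 1) (p * (p * a)) (p * (p * b)) (p * c) m) := by
  have hp0 := (Fact.out : p.Prime).ne_zero
  rw [levelDensity, boxDensity_peel hp ha, boxDensity_swap, boxDensity_peel hp hb, boxDensity_swap]
  have h1 : ∀ y z : ℤ, unitWeight p a (b * y ^ 2 + p * c * z ^ 2 - m)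
      = unitWeight p a (b * y ^ 2 + -m) := fun y z => unitWeight_congr ⟨c * z ^ 2, by ring⟩
  have h2 : ∀ y z : ℤ, unitWeight p b (p * (p * a) * y ^ 2 + p * c * z ^ 2 - m)
      = unitWeight p b (-m) := fun y z => unitWeight_congr ⟨p * a * y ^ 2 + c * z ^ 2, by ring⟩
  simp only [h1, h2, intervalAvg_const (pow_ne_zero _ hp0)]
  rw [intervalAvg_unitWeight hp (by omega) ha hb, unitWeight]
  simp only [dvd_neg]
  ring

theorem levelDensity_two_units_of_not_dvd (hp : p ≠ 2) (k : ℕ) {a b : ℤ} (ha : ¬ (p : ℤ) ∣ a)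
    (hb : ¬ (p : ℤ) ∣ b) (c : ℤ) {m : ℤ} (hm : ¬ (p : ℤ) ∣ m) :
    levelDensity p (k + 1) a b (p * c) m = 1 - 1 / p * legR p (-a * b) := by
  rw [levelDensity_two_units hp k ha hb, boxDensity_mul_left_of_not_dvd (by omega) _ _ _ _ _ _ hm]
  simp only [hm, if_false]
  ring

theorem levelDensity_two_units_mul (hp : p ≠ 2) (k : ℕ) {a b : ℤ} (ha : ¬ (p : ℤ) ∣ a)
    (hb : ¬ (p : ℤ) ∣ b) (c m : ℤ) :
    levelDensity p (k + 1) a b (p * c) (p * m)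
      = (1 - 1 / p) * (1 + legR p (-a * b)) + 1 / p * levelDensity p k (p * a) (p * b) c m := by
  have hpp := (Fact.out : p.Prime).ne_zero
  have hp0 : (p : ℝ) ≠ 0 := by exact_mod_cast hpp
  rw [levelDensity_two_units hp k ha hb, boxDensity_mul_left hpp,
    boxDensity_eq_levelDensity hpp (by omega) (by omega) (by omega)]
  simp only [dvd_mul_right, if_true]
  field_simp
  ring

theorem levelDensity_three_units (hp : p ≠ 2) (k : ℕ) {a b c : ℤ} (ha : ¬ (p : ℤ) ∣ a)
    (hb : ¬ (p : ℤ) ∣ b) (hc : ¬ (p : ℤ) ∣ c) (m : ℤ) :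
    levelDensity p (k + 1) a b c m
      = 1 + (p * legR p (-a * b) * legR p (c * m) - if (p : ℤ) ∣ m then 1 else 0) / p ^ 2
        + 1 / p * (1 / p * (1 / p *
          boxDensity p (k + 1) k k k (p * (p * a)) (p * (p * b)) (p * (p * c)) m)) := by
  have hpp := (Fact.out : p.Prime).ne_zero
  have hp0 : (p : ℝ) ≠ 0 := by exact_mod_cast hpp
  rw [levelDensity, boxDensity_peel hp ha, boxDensity_swap, boxDensity_peel hp hb, boxDensity_swap,
    boxDensity_swap_right, boxDensity_swap, boxDensity_peel hp hc, boxDensity_swap,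
    boxDensity_swap_right]
  have h1 : ∀ y z : ℤ, b * y ^ 2 + c * z ^ 2 - m = b * y ^ 2 + (c * z ^ 2 - m) := fun y z => by ring
  have h2 : ∀ y z : ℤ, unitWeight p b (p * (p * a) * y ^ 2 + c * z ^ 2 - m)
      = unitWeight p b (c * z ^ 2 + -m) := fun y z => unitWeight_congr ⟨p * a * y ^ 2, by ring⟩
  have h3 : ∀ y z : ℤ, unitWeight p c (p * (p * a) * y ^ 2 + p * (p * b) * z ^ 2 - m)
      = unitWeight p c (-m) := fun y z => unitWeight_congr ⟨p * a * y ^ 2 + p * b * z ^ 2, by ring⟩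
  rw [intervalAvg_comm]
  simp only [h1, h2, h3, intervalAvg_const (pow_ne_zero _ hpp)]
  have h4 : intervalAvg (p ^ (k + 1)) (fun z => intervalAvg (p ^ (k + 1)) fun y =>
      unitWeight p a (b * y ^ 2 + (c * z ^ 2 - m)))
      = intervalAvg (p ^ (k + 1)) (fun z => 1 - 1 / p - 1 / p * legR p (-a * b)
        + legR p (-a * b) * (if (p : ℤ) ∣ c * z ^ 2 + -m then 1 else 0)
        - 1 / p * legR p (-b * (c * z ^ 2 + -m))) := by
    refine intervalAvg_congr fun z => ?_
    rw [intervalAvg_unitWeight hp (by omega) ha hb, sub_eq_add_neg (c * z ^ 2)]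
    field_simp
    ring
  -- The average of the Legendre symbol alone (`h7`) is recovered from that of the unit weight by
  -- subtracting its constant and indicator parts.
  have h6 := intervalAvg_unitWeight hp (Nat.succ_le_succ (Nat.zero_le k)) hb hc (-m)
  have h5 := h6
  simp only [unitWeight] at h5
  rw [intervalAvg_sub, intervalAvg_add, intervalAvg_const (pow_ne_zero _ hpp),
    intervalAvg_indicator_sq hp (by omega) hc] at h5
  rw [h4, intervalAvg_sub, intervalAvg_add, intervalAvg_const (pow_ne_zero _ hpp),
    intervalAvg_const_mul, intervalAvg_const_mul, intervalAvg_indicator_sq hp (by omega) hc, h6,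
    unitWeight]
  have h7 : intervalAvg (p ^ (k + 1)) (fun z => legR p (-b * (c * z ^ 2 + -m)))
    = legR p (-b * c) * (p * (if (p : ℤ) ∣ -m then 1 else 0) - 1) / p := by linear_combination h5
  rw [h7]
  simp only [dvd_neg, neg_mul_neg]
  field_simp
  ring

theorem levelDensity_three_units_of_not_dvd (hp : p ≠ 2) (k : ℕ) {a b c : ℤ} (ha : ¬ (p : ℤ) ∣ a)
    (hb : ¬ (p : ℤ) ∣ b) (hc : ¬ (p : ℤ) ∣ c) {m : ℤ} (hm : ¬ (p : ℤ) ∣ m) :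
    levelDensity p (k + 1) a b c m = 1 + 1 / p * (legR p (-a * b) * legR p (c * m)) := by
  have hp0 : (p : ℝ) ≠ 0 := by exact_mod_cast (Fact.out : p.Prime).ne_zero
  rw [levelDensity_three_units hp k ha hb hc, boxDensity_mul_left_of_not_dvd (by omega) _ _ _ _ _ _ hm]
  simp only [hm, if_false]
  field_simp
  ring

theorem levelDensity_three_units_mul (hp : p ≠ 2) (k : ℕ) {a b c : ℤ} (ha : ¬ (p : ℤ) ∣ a)
    (hb : ¬ (p : ℤ) ∣ b) (hc : ¬ (p : ℤ) ∣ c) (m : ℤ) :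
    levelDensity p (k + 1) a b c (p * m)
      = 1 - 1 / p ^ 2 + 1 / p ^ 2 * levelDensity p k (p * a) (p * b) (p * c) m := by
  have hpp := (Fact.out : p.Prime).ne_zero
  have hp0 : (p : ℝ) ≠ 0 := by exact_mod_cast hpp
  rw [levelDensity_three_units hp k ha hb hc, boxDensity_mul_left hpp,
    boxDensity_eq_levelDensity hpp (by omega) (by omega) (by omega),
    legR_eq_zero (s := c * (p * m)) ⟨c * m, by ring⟩]
  simp only [dvd_mul_right, if_true]
  field_simp
  ring

end

/-! ### The closed formula satisfies the same recursions. -/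

section

variable {p : ℕ} [Fact p.Prime]

theorem natCast_prime_pos (p : ℕ) [Fact p.Prime] : (0 : ℝ) < p := by
  exact_mod_cast (Fact.out : p.Prime).pos

theorem rpow_eq_mul_of_eq_add_one (p : ℕ) [Fact p.Prime] {s t : ℝ} (h : s = t + 1) :
    (p : ℝ) ^ s = p * (p : ℝ) ^ t := by
  rw [h, Real.rpow_add_one (natCast_prime_pos p).ne', mul_comm]

theorem densityFormula_zero_of_pos (a b₀ c₀ m₀ : ℤ) {b₁ : ℕ} (hb : 0 < b₁) (c₁ : ℕ) :
    densityFormula p a b₀ c₀ m₀ b₁ c₁ 0 = 1 + legR p (a * m₀) := by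
  simp [densityFormula, hb]

theorem densityFormula_one_of_one_lt (a b₀ c₀ m₀ : ℤ) {b₁ : ℕ} (hb : 1 < b₁) (c₁ : ℕ) :
    densityFormula p a b₀ c₀ m₀ b₁ c₁ 1 = 0 := by
  simp [densityFormula, hb]

theorem legR_sq {s : ℤ} (h : ¬ (p : ℤ) ∣ s) : legR p s ^ 2 = 1 := by
  rw [sq, legR_mul_self h]

/-- Only the leading half-integral power of p changes. All else depends on parities and on
differences of exponents, or on even shifts of powers of ±1. -/
theorem densityFormula_add_two {a b₀ : ℤ} (ha : ¬ (p : ℤ) ∣ a) (hb : ¬ (p : ℤ) ∣ b₀)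
    (c₀ m₀ : ℤ) (b₁ c₁ m₁ : ℕ) :
    densityFormula p a b₀ c₀ m₀ (b₁ + 2) (c₁ + 2) (m₁ + 2)
      = p * densityFormula p a b₀ c₀ m₀ b₁ c₁ m₁ := by
  have h0 : (p : ℝ) ^ (((m₁ + 2 : ℕ) : ℝ) / 2) = p * (p : ℝ) ^ ((m₁ : ℝ) / 2) :=
    rpow_eq_mul_of_eq_add_one p (by push_cast; ring)
  have h1 : (p : ℝ) ^ (((b₁ + 2 : ℕ) : ℝ) / 2) = p * (p : ℝ) ^ ((b₁ : ℝ) / 2) :=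
    rpow_eq_mul_of_eq_add_one p (by push_cast; ring)
  have h2 : (p : ℝ) ^ ((((b₁ + 2 : ℕ) : ℝ) - 1) / 2) = p * (p : ℝ) ^ (((b₁ : ℝ) - 1) / 2) :=
    rpow_eq_mul_of_eq_add_one p (by push_cast; ring)
  have hev : ∀ n : ℕ, Even (n + 2) ↔ Even n := fun n => by simp [parity_simps]
  have hpow : ∀ {x : ℝ} (n : ℕ), x ^ 2 = 1 → x ^ (n + 2) = x ^ n := fun n h => by
    rw [pow_add, h, mul_one]
  have e1 := legR_sq (not_dvd_mul (mt dvd_neg.1 ha) hb)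
  simp only [densityFormula, h0, h1, h2, hev, add_lt_add_iff_right, add_right_comm _ 2 1,
    hpow _ e1, hpow _ (legR_sq ha), hpow _ (legR_sq hb), hpow _ (neg_one_sq (R := ℝ))]
  push_cast
  split_ifs <;> ring_nf

/-- Mirrors the passage from (a, pb₀, ·) to (pa, b₀, ·): the first two coefficients trade roles and
the parities of the other exponents flip. -/
theorem densityFormula_one_add_two {a b₀ : ℤ} (ha : ¬ (p : ℤ) ∣ a) (c₀ m₀ : ℤ) (c₁ m₁ : ℕ) :
    densityFormula p a b₀ c₀ m₀ 1 (c₁ + 2) (m₁ + 1) = densityFormula p b₀ a c₀ m₀ 1 (c₁ + 1) m₁ := by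
  have hpow : legR p a ^ (m₁ + 1 + 1) = legR p a ^ m₁ := by rw [pow_add _ m₁ 2, legR_sq ha, mul_one]
  rcases Nat.eq_zero_or_pos m₁ with rfl | hm
  · simp [densityFormula, legR_sq ha, legR_mul]
  have hm' : ¬ m₁ < 1 := by omega
  have h1 : m₁ + 1 < c₁ + 2 ↔ m₁ < c₁ + 1 := by omega
  simp only [densityFormula, Nat.even_add_one, hm', h1, if_false, ite_not, hpow,
    add_lt_iff_neg_right, Nat.not_lt_zero, Even.zero, not_true]
  push_cast
  split_ifs <;> ring_nf

/-- Here the step leads to (pa, b₀, c₀), which must be reordered with the units first. -/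
theorem densityFormula_one_one (a b₀ c₀ m₀ : ℤ) (m₁ : ℕ) :
    densityFormula p a b₀ c₀ m₀ 1 1 (m₁ + 1) = densityFormula p b₀ c₀ a m₀ 0 1 m₁ := by
  rcases Nat.eq_zero_or_pos m₁ with rfl | hm
  · simp [densityFormula]
    ring
  · rcases Nat.even_or_odd' m₁ with ⟨n, rfl | rfl⟩ <;>
      simp [densityFormula, parity_simps, hm.ne'] <;> ring_nf

theorem densityFormula_zero_zero (a b₀ c₀ m₀ : ℤ) :
    densityFormula p a b₀ c₀ m₀ 0 0 0 = 1 + 1 / p * (legR p (-a * b₀) * legR p (c₀ * m₀)) := by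
  have : (p : ℝ) ^ (-1 : ℝ) = 1 / p := by rw [Real.rpow_neg_one, one_div]
  simp only [densityFormula, legR_mul, CharP.cast_eq_zero]
  norm_num [this]
  ring

theorem densityFormula_zero_zero_one (a b₀ c₀ m₀ : ℤ) :
    densityFormula p a b₀ c₀ m₀ 0 0 1 = 1 - 1 / p ^ 2 := by
  have : (p : ℝ) ^ (-1 : ℝ) = 1 / p := by rw [Real.rpow_neg_one, one_div]
  simp only [densityFormula, legR_mul, CharP.cast_eq_zero]
  norm_num [this]
  ring

theorem densityFormula_zero_zero_add_two (a b₀ c₀ m₀ : ℤ) (m₁ : ℕ) :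
    densityFormula p a b₀ c₀ m₀ 0 0 (m₁ + 2)
      = 1 - 1 / p ^ 2 + 1 / p ^ 2 * (p * densityFormula p a b₀ c₀ m₀ 0 0 m₁) := by
  have hp0 := (natCast_prime_pos p).ne'
  have hev : ∀ n : ℕ, Even (n + 2) ↔ Even n := fun n => by simp [parity_simps]
  have h1 : (p : ℝ) ^ (-(m₁ : ℝ) / 2 - 1) = p * (p : ℝ) ^ (-(m₁ + 2 : ℝ) / 2 - 1) :=
    rpow_eq_mul_of_eq_add_one p (by ring)
  have h2 : (p : ℝ) ^ (-(m₁ + 1 : ℝ) / 2) = p * (p : ℝ) ^ (-(m₁ + 2 + 1 : ℝ) / 2) :=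
    rpow_eq_mul_of_eq_add_one p (by ring)
  simp only [densityFormula, hev, Nat.not_lt_zero, if_false, Even.zero, if_true]
  push_cast
  simp only [zero_div, Real.rpow_zero, add_zero, h1, h2]
  split_ifs <;> field_simp <;> ring

theorem densityFormula_zero_succ_zero (a b₀ c₀ m₀ : ℤ) (c₁ : ℕ) :
    densityFormula p a b₀ c₀ m₀ 0 (c₁ + 1) 0 = 1 - 1 / p * legR p (-a * b₀) := by
  simp [densityFormula]

theorem densityFormula_zero_one_succ (a b₀ c₀ m₀ : ℤ) (m₁ : ℕ) :
    densityFormula p a b₀ c₀ m₀ 0 1 (m₁ + 1)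
      = (1 - 1 / p) * (1 + legR p (-a * b₀)) + 1 / p * densityFormula p c₀ a b₀ m₀ 1 1 m₁ := by
  have hp0 := (natCast_prime_pos p).ne'
  rcases Nat.eq_zero_or_pos m₁ with rfl | hm
  · simp only [densityFormula]
    norm_num [Real.rpow_neg_one]
    ring
  have h1 : (p : ℝ) ^ (-(m₁ : ℝ) / 2) = p * (p : ℝ) ^ (-(m₁ + 1 + 1 : ℝ) / 2) :=
    rpow_eq_mul_of_eq_add_one p (by ring)
  have h2 : (p : ℝ) ^ ((-(m₁ : ℝ) + 1) / 2) = p * (p : ℝ) ^ (-(m₁ + 1 : ℝ) / 2) :=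
    rpow_eq_mul_of_eq_add_one p (by ring)
  have hm' : ¬ m₁ < 1 := by omega
  simp only [densityFormula, Nat.not_lt_zero, if_false, Even.zero, if_true, Nat.even_add_one,
    add_lt_iff_neg_right, hm', ite_not]
  push_cast
  simp only [zero_div, Real.rpow_zero, add_zero, sub_self, h1, h2]
  split_ifs <;> simp_all <;> field_simp <;> ring

theorem densityFormula_zero_add_two_one {a b₀ : ℤ} (ha : ¬ (p : ℤ) ∣ a) (hb : ¬ (p : ℤ) ∣ b₀)
    (c₀ m₀ : ℤ) (c₁ : ℕ) :
    densityFormula p a b₀ c₀ m₀ 0 (c₁ + 2) 1 = (1 - 1 / p) * (1 + legR p (-a * b₀)) := by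
  have e1 := legR_sq (not_dvd_mul (mt dvd_neg.1 ha) hb)
  simp only [densityFormula, e1]
  norm_num
  ring

theorem densityFormula_zero_add_two_add_two {a b₀ : ℤ} (ha : ¬ (p : ℤ) ∣ a)
    (hb : ¬ (p : ℤ) ∣ b₀) (c₀ m₀ : ℤ) (c₁ m₁ : ℕ) :
    densityFormula p a b₀ c₀ m₀ 0 (c₁ + 2) (m₁ + 2)
      = (1 - 1 / p) * (1 + legR p (-a * b₀)) + densityFormula p a b₀ c₀ m₀ 0 c₁ m₁ := by
  have e1 := legR_sq (not_dvd_mul (mt dvd_neg.1 ha) hb)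
  have hev : ∀ n : ℕ, Even (n + 2) ↔ Even n := fun n => by simp [parity_simps]
  have hpow : ∀ {x : ℝ} (n : ℕ), x ^ 2 = 1 → x ^ (n + 2) = x ^ n := fun n h => by
    rw [pow_add, h, mul_one]
  simp only [densityFormula, hev, add_lt_add_iff_right, add_right_comm _ 2 1,
    hpow _ e1, hpow _ (neg_one_sq (R := ℝ)), Nat.not_lt_zero, if_false, Even.zero, if_true]
  push_cast
  simp only [zero_div, Real.rpow_zero]
  split_ifs <;> ring_nf

end

/-! ### Descent for nonzero m, and the notion of a limit at zero. -/

section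

/-- The level densities at `m` tend to `L` as `m` tends to `0` `p`-adically, at all levels that see
`m` as close to `0`. -/
def HasZeroLimit (p : ℕ) (a b c : ℤ) (L : ℝ) : Prop :=
  ∀ ε > 0, ∃ e : ℕ, ∀ k ≥ e, ∀ m : ℤ, |levelDensity p k a b c (p ^ e * m) - L| ≤ ε

theorem HasZeroLimit.swap {p : ℕ} {a b c : ℤ} {L : ℝ} (h : HasZeroLimit p a b c L) :
    HasZeroLimit p b a c L := by
  simpa only [HasZeroLimit, levelDensity_swap p _ b a c] using h

theorem HasZeroLimit.swap_right {p : ℕ} {a b c : ℤ} {L : ℝ} (h : HasZeroLimit p a b c L) :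
    HasZeroLimit p a c b L := by
  simpa only [HasZeroLimit, levelDensity_swap_right p _ a c b] using h

/-- Transfer of limits along a one-step affine recursion. -/
theorem HasZeroLimit.step {p : ℕ} {a b c a' b' c' : ℤ} {L α β : ℝ} (h : HasZeroLimit p a b c L)
    (hrec : ∀ k m, levelDensity p (k + 1) a' b' c' (p * m) = α + β * levelDensity p k a b c m) :
    HasZeroLimit p a' b' c' (α + β * L) := by
  intro ε hε
  obtain ⟨e, he⟩ := h (ε / (|β| + 1)) (by positivity)
  refine ⟨e + 1, fun k hk m => ?_⟩
  obtain ⟨k, rfl⟩ := Nat.exists_eq_add_of_le' (show 1 ≤ k by omega)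
  rw [pow_succ', mul_assoc, hrec]
  have := he k (by omega) m
  rw [show α + β * levelDensity p k a b c (p ^ e * m) - (α + β * L)
    = β * (levelDensity p k a b c (p ^ e * m) - L) by ring, abs_mul]
  calc |β| * |levelDensity p k a b c (p ^ e * m) - L| ≤ (|β| + 1) * (ε / (|β| + 1)) := by
        gcongr; linarith
    _ = ε := by field_simp

variable {p : ℕ} [Fact p.Prime]

theorem mul_pow_succ_eq (x : ℤ) (p n : ℕ) : x * (p : ℤ) ^ (n + 1) = p * (x * (p : ℤ) ^ n) := by
  rw [pow_succ']; ring

theorem mul_pow_add_two_eq (x : ℤ) (p n : ℕ) :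
    x * (p : ℤ) ^ (n + 2) = p * (p * (x * (p : ℤ) ^ n)) := by
  rw [mul_pow_succ_eq, mul_pow_succ_eq]

/-- Strong induction on the valuation m₁. The coefficients are generalised because a step may
disturb the order of their valuations and require a permutation. Every step lowers k and m₁ equally,
so m₁ < k persists and one level is left to see the unit m₀. -/
theorem levelDensity_eq_densityFormula (hp : p ≠ 2) (m₁ : ℕ) {a b₀ c₀ m₀ : ℤ}
    (ha : ¬ (p : ℤ) ∣ a) (hb : ¬ (p : ℤ) ∣ b₀) (hc : ¬ (p : ℤ) ∣ c₀) (hm : ¬ (p : ℤ) ∣ m₀)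
    {b₁ c₁ : ℕ} (hbc : b₁ ≤ c₁) {k : ℕ} (hk : m₁ < k) :
    levelDensity p k a (b₀ * (p : ℤ) ^ b₁) (c₀ * (p : ℤ) ^ c₁) (m₀ * (p : ℤ) ^ m₁)
      = densityFormula p a b₀ c₀ m₀ b₁ c₁ m₁ := by
  induction m₁ using Nat.strong_induction_on generalizing a b₀ c₀ b₁ c₁ k with
  | _ m₁ ih =>
  obtain ⟨k, rfl⟩ := Nat.exists_eq_add_of_lt (Nat.zero_lt_of_lt hk)
  rw [zero_add] at hk ⊢
  match b₁, c₁, m₁ with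
  | b₁ + 1, c₁ + 1, 0 =>
    rw [mul_pow_succ_eq, mul_pow_succ_eq, pow_zero, mul_one,
      levelDensity_one_unit_of_not_dvd hp k ha _ _ hm, densityFormula_zero_of_pos _ _ _ _ (by omega)]
  | b₁ + 2, c₁ + 2, 1 =>
    obtain ⟨k, rfl⟩ := Nat.exists_eq_add_of_le' (show 1 ≤ k by omega)
    rw [mul_pow_add_two_eq, mul_pow_add_two_eq, pow_one, mul_comm m₀,
      levelDensity_one_unit_mul hp _ ha, levelDensity_mul_of_not_dvd _ _ _ _ hm,
      densityFormula_one_of_one_lt _ _ _ _ (by omega)]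
  | b₁ + 2, c₁ + 2, m₁ + 2 =>
    obtain ⟨k, rfl⟩ := Nat.exists_eq_add_of_le' (show 1 ≤ k by omega)
    rw [mul_pow_add_two_eq, mul_pow_add_two_eq, mul_pow_add_two_eq,
      levelDensity_one_unit_mul hp _ ha, levelDensity_mul, densityFormula_add_two ha hb,
      ih m₁ (by omega) ha hb hc (by omega) (by omega)]
  | 1, c₁ + 2, m₁ + 1 =>
    have h := ih m₁ (by omega) hb ha hc (show 1 ≤ c₁ + 1 by omega) (show m₁ < k by omega)
    rw [pow_one, mul_comm a] at h
    rw [pow_one, mul_comm b₀, mul_pow_succ_eq c₀, mul_pow_succ_eq m₀,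
      levelDensity_one_unit_mul hp _ ha, levelDensity_swap, h, densityFormula_one_add_two ha]
  | 1, 1, m₁ + 1 =>
    have h := ih m₁ (by omega) hb hc ha (show 0 ≤ 1 by omega) (show m₁ < k by omega)
    rw [pow_one, pow_zero, mul_one, mul_comm a] at h
    rw [pow_one, mul_comm b₀, mul_comm c₀, mul_pow_succ_eq m₀,
      levelDensity_one_unit_mul hp _ ha, levelDensity_swap, levelDensity_swap_right, h,
      densityFormula_one_one]
  | 0, 0, 0 =>
    simp only [pow_zero, mul_one]
    rw [levelDensity_three_units_of_not_dvd hp k ha hb hc hm, densityFormula_zero_zero]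
  | 0, 0, 1 =>
    obtain ⟨k, rfl⟩ := Nat.exists_eq_add_of_le' (show 1 ≤ k by omega)
    simp only [pow_zero, mul_one, pow_one]
    rw [mul_comm m₀, levelDensity_three_units_mul hp _ ha hb hc,
      levelDensity_mul_of_not_dvd _ _ _ _ hm, densityFormula_zero_zero_one, mul_zero, add_zero]
  | 0, 0, m₁ + 2 =>
    obtain ⟨k, rfl⟩ := Nat.exists_eq_add_of_le' (show 1 ≤ k by omega)
    have h := ih m₁ (by omega) ha hb hc (le_refl 0) (show m₁ < k by omega)
    simp only [pow_zero, mul_one] at h ⊢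
    rw [mul_pow_add_two_eq, levelDensity_three_units_mul hp _ ha hb hc, levelDensity_mul, h,
      densityFormula_zero_zero_add_two]
  | 0, c₁ + 1, 0 =>
    simp only [pow_zero, mul_one]
    rw [mul_pow_succ_eq, levelDensity_two_units_of_not_dvd hp k ha hb _ hm,
      densityFormula_zero_succ_zero]
  | 0, 1, m₁ + 1 =>
    have h := ih m₁ (by omega) hc ha hb (le_refl 1) (show m₁ < k by omega)
    simp only [pow_zero, mul_one, pow_one] at h ⊢
    rw [mul_comm a, mul_comm b₀] at h
    rw [mul_comm c₀, mul_pow_succ_eq, levelDensity_two_units_mul hp k ha hb,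
      levelDensity_swap_right, levelDensity_swap, h, densityFormula_zero_one_succ]
  | 0, c₁ + 2, 1 =>
    obtain ⟨k, rfl⟩ := Nat.exists_eq_add_of_le' (show 1 ≤ k by omega)
    simp only [pow_zero, mul_one, pow_one]
    rw [mul_comm m₀, mul_pow_add_two_eq, levelDensity_two_units_mul hp _ ha hb,
      levelDensity_mul_of_not_dvd _ _ _ _ hm, densityFormula_zero_add_two_one ha hb, mul_zero,
      add_zero]
  | 0, c₁ + 2, m₁ + 2 =>
    obtain ⟨k, rfl⟩ := Nat.exists_eq_add_of_le' (show 1 ≤ k by omega)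
    have h := ih m₁ (by omega) ha hb hc (Nat.zero_le c₁) (show m₁ < k by omega)
    have hp0 := (natCast_prime_pos p).ne'
    simp only [pow_zero, mul_one] at h ⊢
    rw [mul_pow_add_two_eq, mul_pow_add_two_eq, levelDensity_two_units_mul hp _ ha hb,
      levelDensity_mul, h, densityFormula_zero_add_two_add_two ha hb]
    field_simp

theorem HasZeroLimit.mul {a b c : ℤ} {L : ℝ} (h : HasZeroLimit p a b c L) :
    HasZeroLimit p (p * a) (p * b) (p * c) (p * L) := by
  simpa using h.step (α := 0) (β := p) fun k m => by rw [levelDensity_mul, zero_add]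

theorem HasZeroLimit.one_unit (hp : p ≠ 2) {a b c : ℤ} {L : ℝ} (ha : ¬ (p : ℤ) ∣ a)
    (h : HasZeroLimit p (p * a) b c L) : HasZeroLimit p a (p * b) (p * c) L := by
  simpa using h.step (α := 0) (β := 1) fun k m => by
    rw [levelDensity_one_unit_mul hp k ha, zero_add, one_mul]

theorem HasZeroLimit.two_units (hp : p ≠ 2) {a b c : ℤ} {L : ℝ} (ha : ¬ (p : ℤ) ∣ a)
    (hb : ¬ (p : ℤ) ∣ b) (h : HasZeroLimit p (p * a) (p * b) c L) :
    HasZeroLimit p a b (p * c) ((1 - 1 / p) * (1 + legR p (-a * b)) + 1 / p * L) :=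
  h.step fun k m => levelDensity_two_units_mul hp k ha hb c m

/-- A two-step contraction with bounded initial values converges to its fixed point. -/
theorem hasZeroLimit_of_contraction {a b c : ℤ} {α B L : ℝ} (hL : L = α + 1 / p * L)
    (hrec : ∀ k m, levelDensity p (k + 2) a b c (p * (p * m))
      = α + 1 / p * levelDensity p k a b c m)
    (hB : ∀ k m, (k ≤ 1 ∨ ¬ (p : ℤ) * p ∣ m) → |levelDensity p k a b c m - L| ≤ B) :
    HasZeroLimit p a b c L := by
  have hp1 : (1 : ℝ) < p := by exact_mod_cast (Fact.out : p.Prime).one_lt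
  have hp0 : (0 : ℝ) < p := natCast_prime_pos p
  have hB0 : 0 ≤ B := (abs_nonneg _).trans (hB 0 0 (by simp))
  have hstep : ∀ k m, levelDensity p (k + 2) a b c (p * (p * m)) - L
      = 1 / p * (levelDensity p k a b c m - L) := by
    intro k m
    rw [hrec]
    linear_combination -hL
  -- The hypothesis `hB` covers exactly the pairs that a double step cannot reach; every other pair
  -- inherits the bound.
  have hbound : ∀ k m, |levelDensity p k a b c m - L| ≤ B := by
    intro k
    induction k using Nat.strong_induction_on with
    | _ k ih =>
      intro m
      by_cases h : k ≤ 1 ∨ ¬ (p : ℤ) * p ∣ m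
      · exact hB k m h
      · push Not at h
        obtain ⟨hk, m, rfl⟩ := h
        obtain ⟨k, rfl⟩ := Nat.exists_eq_add_of_le' (show 2 ≤ k by omega)
        rw [mul_assoc, hstep, abs_mul, abs_of_pos (by positivity)]
        refine (mul_le_of_le_one_left (abs_nonneg _) ?_).trans (ih k (by omega) m)
        rw [div_le_one hp0]
        exact hp1.le
  have hiter : ∀ n k m, |levelDensity p (k + 2 * n) a b c (p ^ (2 * n) * m) - L|
      ≤ (1 / p) ^ n * B := by
    intro n
    induction n with
    | zero => simpa using hbound
    | succ n ih =>
      intro k m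
      rw [show (p : ℤ) ^ (2 * (n + 1)) * m = p * (p * (p ^ (2 * n) * m)) by ring,
        show k + 2 * (n + 1) = k + 2 * n + 2 by ring, hstep, abs_mul, abs_of_pos (by positivity),
        pow_succ', mul_assoc]
      gcongr
      exact ih k m
  intro ε hε
  have hlim : Tendsto (fun n : ℕ => (1 / (p : ℝ)) ^ n * B) atTop (𝓝 0) := by
    simpa using (tendsto_pow_atTop_nhds_zero_of_lt_one (by positivity)
      ((div_lt_one hp0).2 hp1)).mul_const B
  obtain ⟨n, hn⟩ := (hlim.eventually (gt_mem_nhds hε)).exists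
  -- Each of the n contractions uses up two levels and a factor p² of the argument.
  refine ⟨2 * n, fun k hk m => ?_⟩
  obtain ⟨k, rfl⟩ := Nat.exists_eq_add_of_le' hk
  exact (hiter n k m).trans hn.le

end

/-! ### The limit at m = 0. -/

section

variable {p : ℕ} [Fact p.Prime]

theorem abs_legR_le_one (s : ℤ) : |legR p s| ≤ 1 := by
  by_cases h : (p : ℤ) ∣ s
  · simp [legR_eq_zero h]
  · exact abs_le_one_iff_mul_self_le_one.2 (legR_mul_self h).le

theorem abs_one_div_prime_le_one (p : ℕ) [Fact p.Prime] : |1 / (p : ℝ)| ≤ 1 := by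
  have hp1 : (1 : ℝ) ≤ p := by exact_mod_cast (Fact.out : p.Prime).one_le
  rw [abs_of_pos (by positivity)]
  exact (div_le_one (by positivity)).2 hp1

theorem not_mul_self_dvd_mul_iff (m : ℤ) : ¬ (p : ℤ) * p ∣ p * m ↔ ¬ (p : ℤ) ∣ m := by
  rw [mul_dvd_mul_iff_left (by exact_mod_cast (Fact.out : p.Prime).ne_zero)]

/-- Two steps lead through (pa, pb, pc) back to (a, b, c) with factor p/p², and 1 + 1/p is the fixed
point of L = 1 − 1/p² + L/p. The bound 2 is crude. -/
theorem hasZeroLimit_three_units (hp : p ≠ 2) {a b c : ℤ} (ha : ¬ (p : ℤ) ∣ a)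
    (hb : ¬ (p : ℤ) ∣ b) (hc : ¬ (p : ℤ) ∣ c) : HasZeroLimit p a b c (1 + 1 / p) := by
  have hp0 := (natCast_prime_pos p).ne'
  have hi := abs_le.1 (abs_one_div_prime_le_one p)
  refine hasZeroLimit_of_contraction (α := 1 - 1 / p ^ 2) (B := 2) ?_ ?_ ?_
  · field_simp; ring
  · intro k m
    rw [levelDensity_three_units_mul hp _ ha hb hc, levelDensity_mul]
    field_simp
  · intro k m h
    match k with
    | 0 => rw [levelDensity_zero, abs_le]; constructor <;> linarith
    | k + 1 =>
      by_cases hm : (p : ℤ) ∣ m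
      · obtain ⟨m, rfl⟩ := hm
        rw [levelDensity_three_units_mul hp _ ha hb hc]
        match k with
        | 0 => rw [levelDensity_zero, mul_one, abs_le]; constructor <;> linarith
        | k + 1 =>
          rw [levelDensity_mul_of_not_dvd _ _ _ _ (by
            rwa [or_iff_right (by omega), not_mul_self_dvd_mul_iff] at h), ← one_div_pow]
          rw [abs_le]; constructor <;> nlinarith
      · rw [levelDensity_three_units_of_not_dvd hp _ ha hb hc hm]
        have h1 : |1 / (p : ℝ) * (legR p (-a * b) * legR p (c * m))| ≤ 1 := by
          rw [abs_mul, abs_mul]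
          exact mul_le_one₀ (abs_one_div_prime_le_one p) (by positivity)
            (mul_le_one₀ (abs_legR_le_one _) (abs_nonneg _) (abs_legR_le_one _))
        have h2 := abs_le.1 h1
        rw [abs_le]; constructor <;> linarith

theorem levelDensity_two_units_add_two (hp : p ≠ 2) (k : ℕ) {a b c : ℤ} (ha : ¬ (p : ℤ) ∣ a)
    (hb : ¬ (p : ℤ) ∣ b) (hc : ¬ (p : ℤ) ∣ c) (m : ℤ) :
    levelDensity p (k + 2) a b (p * c) (p * (p * m))
      = (1 - 1 / p) * (1 + legR p (-a * b)) + 1 / p * levelDensity p k a b (p * c) m := by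
  rw [levelDensity_two_units_mul hp _ ha hb, levelDensity_swap_right, levelDensity_swap,
    levelDensity_one_unit_mul hp _ hc, levelDensity_swap, levelDensity_swap_right]

/-- Two steps pass through (pa, pb, c), where c is the only unit, and return with factor 1/p. The
fixed-point equation is (1 − 1/p)L = (1 − 1/p)(1 + χ(−ab)), with χ the Legendre symbol. -/
theorem hasZeroLimit_two_units (hp : p ≠ 2) {a b c : ℤ} (ha : ¬ (p : ℤ) ∣ a)
    (hb : ¬ (p : ℤ) ∣ b) (hc : ¬ (p : ℤ) ∣ c) :
    HasZeroLimit p a b (p * c) (1 + legR p (-a * b)) := by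
  have hp0 := (natCast_prime_pos p).ne'
  have hi := abs_le.1 (abs_one_div_prime_le_one p)
  have hle := abs_le.1 (abs_legR_le_one (p := p) (-a * b))
  have hprod : |1 / (p : ℝ) * legR p (-a * b)| ≤ 1 := by
    rw [abs_mul]
    exact mul_le_one₀ (abs_one_div_prime_le_one p) (by positivity) (abs_legR_le_one _)
  have hprod' := abs_le.1 hprod
  refine hasZeroLimit_of_contraction (B := 3) ?_
    (fun k m => levelDensity_two_units_add_two hp k ha hb hc m) ?_
  · field_simp; ring
  · intro k m h
    match k with
    | 0 => rw [levelDensity_zero, abs_le]; constructor <;> linarith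
    | k + 1 =>
      by_cases hm : (p : ℤ) ∣ m
      · obtain ⟨m, rfl⟩ := hm
        rw [levelDensity_two_units_mul hp _ ha hb]
        match k with
        | 0 => rw [levelDensity_zero, mul_one, abs_le]; constructor <;> linarith
        | k + 1 =>
          rw [levelDensity_swap_right, levelDensity_swap,
            levelDensity_one_unit_of_not_dvd hp _ hc _ _ (by
              rwa [or_iff_right (by omega), not_mul_self_dvd_mul_iff] at h)]
          have h1 : |1 / (p : ℝ) * legR p (c * m)| ≤ 1 := by
            rw [abs_mul]
            exact mul_le_one₀ (abs_one_div_prime_le_one p) (by positivity) (abs_legR_le_one _)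
          have h2 := abs_le.1 h1
          rw [abs_le]; constructor <;> linarith
      · rw [levelDensity_two_units_of_not_dvd hp _ ha hb _ hm]
        rw [abs_le]; constructor <;> linarith

theorem densityFormulaZero_add_two (a b₀ c₀ : ℤ) (b₁ c₁ : ℕ) :
    densityFormulaZero p a b₀ c₀ (b₁ + 2) (c₁ + 2) = p * densityFormulaZero p a b₀ c₀ b₁ c₁ := by
  have h1 : (p : ℝ) ^ (((b₁ + 2 : ℕ) : ℝ) / 2) = p * (p : ℝ) ^ ((b₁ : ℝ) / 2) :=
    rpow_eq_mul_of_eq_add_one p (by push_cast; ring)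
  have h2 : (p : ℝ) ^ ((((b₁ + 2 : ℕ) : ℝ) - 1) / 2) = p * (p : ℝ) ^ (((b₁ : ℝ) - 1) / 2) :=
    rpow_eq_mul_of_eq_add_one p (by push_cast; ring)
  have hev : ∀ n : ℕ, Even (n + 2) ↔ Even n := fun n => by simp [parity_simps]
  simp only [densityFormulaZero, h1, h2, hev]
  push_cast
  split_ifs <;> ring_nf

theorem densityFormulaZero_one_add_two (a b₀ c₀ : ℤ) (c₁ : ℕ) :
    densityFormulaZero p a b₀ c₀ 1 (c₁ + 2) = densityFormulaZero p b₀ a c₀ 1 (c₁ + 1) := by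
  simp only [densityFormulaZero, Nat.even_add_one, ite_not]
  simp

theorem densityFormulaZero_zero_zero (a b₀ c₀ : ℤ) :
    densityFormulaZero p a b₀ c₀ 0 0 = 1 + 1 / p := by
  simp [densityFormulaZero]

theorem densityFormulaZero_zero_one (a b₀ c₀ : ℤ) :
    densityFormulaZero p a b₀ c₀ 0 1 = 1 + legR p (-a * b₀) := by
  simp [densityFormulaZero]
  ring

theorem densityFormulaZero_one_one (a b₀ c₀ : ℤ) :
    densityFormulaZero p a b₀ c₀ 1 1 = 1 + legR p (-b₀ * c₀) := by
  simp [densityFormulaZero]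

theorem densityFormulaZero_zero_add_two (a b₀ c₀ : ℤ) (c₁ : ℕ) :
    densityFormulaZero p a b₀ c₀ 0 (c₁ + 2)
      = (1 - 1 / p) * (1 + legR p (-a * b₀)) + 1 / p * (p * densityFormulaZero p a b₀ c₀ 0 c₁) := by
  have hp0 := (natCast_prime_pos p).ne'
  have hev : ∀ n : ℕ, Even (n + 2) ↔ Even n := fun n => by simp [parity_simps]
  simp only [densityFormulaZero, hev, Even.zero, if_true]
  push_cast
  simp only [zero_div, Real.rpow_zero]
  split_ifs <;> field_simp <;> ring

/-- Each step lowers the largest exponent c₁, up to reordering, until one of the two contracting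
forms is reached. -/
theorem hasZeroLimit_densityFormulaZero (hp : p ≠ 2) {a b₀ c₀ : ℤ}
    (ha : ¬ (p : ℤ) ∣ a) (hb : ¬ (p : ℤ) ∣ b₀) (hc : ¬ (p : ℤ) ∣ c₀)
    {b₁ c₁ : ℕ} (hbc : b₁ ≤ c₁) :
    HasZeroLimit p a (b₀ * (p : ℤ) ^ b₁) (c₀ * (p : ℤ) ^ c₁)
      (densityFormulaZero p a b₀ c₀ b₁ c₁) := by
  induction c₁ using Nat.strong_induction_on generalizing a b₀ c₀ b₁ with
  | _ c₁ ih =>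
  match b₁, c₁ with
  | b₁ + 2, c₁ + 2 =>
    rw [mul_pow_add_two_eq, mul_pow_add_two_eq, densityFormulaZero_add_two]
    exact .one_unit hp ha (.mul (ih c₁ (by omega) ha hb hc (by omega)))
  | 1, c₁ + 2 =>
    have h := ih (c₁ + 1) (by omega) hb ha hc (show 1 ≤ c₁ + 1 by omega)
    rw [pow_one, mul_comm a] at h
    rw [pow_one, mul_comm b₀, mul_pow_succ_eq c₀, densityFormulaZero_one_add_two]
    exact .one_unit hp ha h.swap
  | 1, 1 =>
    rw [pow_one, mul_comm b₀, mul_comm c₀, densityFormulaZero_one_one]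
    exact .one_unit hp ha (hasZeroLimit_two_units hp hb hc ha).swap_right.swap
  | 0, 0 =>
    rw [pow_zero, mul_one, mul_one, densityFormulaZero_zero_zero]
    exact hasZeroLimit_three_units hp ha hb hc
  | 0, 1 =>
    rw [pow_zero, pow_one, mul_one, mul_comm c₀, densityFormulaZero_zero_one]
    exact hasZeroLimit_two_units hp ha hb hc
  | 0, c₁ + 2 =>
    have h := ih c₁ (by omega) ha hb hc (Nat.zero_le _)
    rw [pow_zero, mul_one] at h ⊢
    rw [mul_pow_add_two_eq, densityFormulaZero_zero_add_two]
    exact .two_units hp ha hb h.mul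

end

/-! ### From counts mod p^k to Haar volumes. -/

section

variable {p : ℕ} [Fact p.Prime]

theorem localRepNumber_eq_sum (n : ℕ) [NeZero n] (a b c m : ℤ) :
    (localRepNumber n a b c m : ℝ) = ∑ x : ZMod n, ∑ y : ZMod n, ∑ z : ZMod n,
      if (a * x ^ 2 + b * y ^ 2 + c * z ^ 2 : ZMod n) = m then (1 : ℝ) else 0 := by
  classical
  let E : (Fin 3 → ZMod n) ≃ ZMod n × ZMod n × ZMod n :=
    { toFun := fun v => (v 0, v 1, v 2)
      invFun := fun t => ![t.1, t.2.1, t.2.2]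
      left_inv := fun v => by ext i; fin_cases i <;> rfl
      right_inv := fun t => rfl }
  rw [localRepNumber, Nat.card_eq_fintype_card, Fintype.card_subtype, ← Finset.sum_boole]
  simp only [← Fintype.sum_prod_type']
  exact Fintype.sum_equiv E _ _ fun v => rfl

theorem localRepNumber_div_eq_levelDensity (k : ℕ) (a b c m : ℤ) :
    (localRepNumber (p ^ k) a b c m : ℝ) / (p : ℝ) ^ (2 * k) = levelDensity p k a b c m := by
  have hp0 := (natCast_prime_pos p).ne'
  have : NeZero (p ^ k) := ⟨pow_ne_zero _ (Fact.out : p.Prime).ne_zero⟩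
  have key : ∀ x y z : ℕ,
      ((p : ℤ) ^ k ∣ a * (x : ℤ) ^ 2 + b * (y : ℤ) ^ 2 + c * (z : ℤ) ^ 2 - m) ↔
      (a * (x : ZMod (p ^ k)) ^ 2 + b * (y : ZMod (p ^ k)) ^ 2 + c * (z : ZMod (p ^ k)) ^ 2 = m) := by
    intro x y z
    have := ZMod.intCast_zmod_eq_zero_iff_dvd
      (a * (x : ℤ) ^ 2 + b * (y : ℤ) ^ 2 + c * (z : ℤ) ^ 2 - m) (p ^ k)
    push_cast at this
    rw [← this, sub_eq_zero]
  rw [localRepNumber_eq_sum, levelDensity, boxDensity]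
  simp only [intervalAvg, key, ← Finset.sum_div]
  simp only [← sum_range_eq_sum_zmod]
  push_cast
  field_simp
  ring

theorem toZModPow_eq_iff_norm_sub_le (k : ℕ) (x y : ℤ_[p]) :
    PadicInt.toZModPow k x = PadicInt.toZModPow k y ↔ ‖x - y‖ ≤ (p : ℝ) ^ (-k : ℤ) := by
  rw [PadicInt.norm_le_pow_iff_mem_span_pow, ← PadicInt.ker_toZModPow, RingHom.mem_ker, map_sub,
    sub_eq_zero]

theorem isOpen_toZModPow_preimage (k : ℕ) (S : Set (ZMod (p ^ k))) :
    IsOpen (PadicInt.toZModPow (p := p) k ⁻¹' S) := by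
  rw [Metric.isOpen_iff]
  intro x hx
  have hp := natCast_prime_pos p
  refine ⟨(p : ℝ) ^ (-k : ℤ), by positivity, fun y hy => ?_⟩
  have : PadicInt.toZModPow k y = PadicInt.toZModPow k x :=
    (toZModPow_eq_iff_norm_sub_le k y x).2 (by rw [← dist_eq_norm]; exact (Metric.mem_ball.1 hy).le)
  rwa [Set.mem_preimage, this]

instance padicVol_isAddHaarMeasure (p : ℕ) [Fact p.Prime] : (padicVol p).IsAddHaarMeasure :=
  inferInstanceAs (Measure.IsAddHaarMeasure (Measure.addHaarMeasure _))

instance padicVol_isProbabilityMeasure (p : ℕ) [Fact p.Prime] : IsProbabilityMeasure (padicVol p) :=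
  ⟨Measure.addHaarMeasure_self⟩

instance padicVol3_isProbabilityMeasure (p : ℕ) [Fact p.Prime] :
    IsProbabilityMeasure (padicVol3 p) :=
  inferInstanceAs (IsProbabilityMeasure (Measure.pi _))

/-- The p^k residue classes are translates of one another and partition a space of mass 1. -/
theorem padicVol_real_residue_fiber (k : ℕ) (s : ZMod (p ^ k)) :
    (padicVol p).real (PadicInt.toZModPow (p := p) k ⁻¹' {s}) = 1 / (p : ℝ) ^ k := by
  have hp := natCast_prime_pos p
  have : NeZero (p ^ k) := ⟨pow_ne_zero _ (Fact.out : p.Prime).ne_zero⟩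
  have htrans : ∀ s : ZMod (p ^ k), (padicVol p).real (PadicInt.toZModPow (p := p) k ⁻¹' {s})
      = (padicVol p).real (PadicInt.toZModPow (p := p) k ⁻¹' {0}) := by
    intro s
    obtain ⟨t, rfl⟩ := ZMod.ringHom_surjective (PadicInt.toZModPow (p := p) k) s
    rw [measureReal_def, ← measure_preimage_add (padicVol p) t, measureReal_def]
    congr 2
    ext x
    simp
  have hsum := sum_measureReal_preimage_singleton (μ := padicVol p) Finset.univ
    (f := PadicInt.toZModPow (p := p) k) fun s _ => (isOpen_toZModPow_preimage k {s}).measurableSet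
  simp only [htrans, Finset.sum_const, Finset.card_univ, ZMod.card, Finset.coe_univ,
    Set.preimage_univ, probReal_univ, nsmul_eq_mul] at hsum
  rw [htrans, eq_div_iff (by positivity), mul_comm]
  exact_mod_cast hsum

/-- Reduction of a triple of `p`-adic integers modulo `p^k`. -/
def reduceTriple (p : ℕ) [Fact p.Prime] (k : ℕ) (v : Fin 3 → ℤ_[p]) : Fin 3 → ZMod (p ^ k) :=
  fun i => PadicInt.toZModPow k (v i)

theorem reduceTriple_preimage_singleton (k : ℕ) (w : Fin 3 → ZMod (p ^ k)) :
    reduceTriple p k ⁻¹' {w} = Set.univ.pi fun i => PadicInt.toZModPow (p := p) k ⁻¹' {w i} := by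
  ext v
  simp [reduceTriple, funext_iff]

theorem measurableSet_reduceTriple_preimage_singleton (k : ℕ) (w : Fin 3 → ZMod (p ^ k)) :
    MeasurableSet (reduceTriple p k ⁻¹' {w}) := by
  rw [reduceTriple_preimage_singleton]
  exact MeasurableSet.univ_pi fun i => (isOpen_toZModPow_preimage k {w i}).measurableSet

theorem padicVol3_real_reduceTriple_preimage_singleton (k : ℕ) (w : Fin 3 → ZMod (p ^ k)) :
    (padicVol3 p).real (reduceTriple p k ⁻¹' {w}) = 1 / (p : ℝ) ^ (3 * k) := by
  have h := padicVol_real_residue_fiber (p := p) k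
  simp only [measureReal_def] at h
  rw [reduceTriple_preimage_singleton, measureReal_def, padicVol3, Measure.pi_pi,
    ENNReal.toReal_prod]
  simp only [h, Finset.prod_const, Finset.card_univ, Fintype.card_fin]
  rw [div_pow, one_pow, ← pow_mul, mul_comm k]

theorem toZModPow_ternaryForm (k : ℕ) (a b c : ℤ) (v : Fin 3 → ℤ_[p]) :
    PadicInt.toZModPow k (ternaryForm a b c v) = ternaryForm a b c (reduceTriple p k v) := by
  simp [ternaryForm, reduceTriple]

theorem toZModPow_ternaryForm_preimage (k : ℕ) (a b c : ℤ) (s : ZMod (p ^ k)) :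
    (fun v : Fin 3 → ℤ_[p] => PadicInt.toZModPow k (ternaryForm a b c v)) ⁻¹' {s}
      = reduceTriple p k ⁻¹' {w | ternaryForm a b c w = s} := by
  ext v
  simp [toZModPow_ternaryForm]

theorem measurableSet_toZModPow_ternaryForm_fiber (k : ℕ) (a b c : ℤ) (s : ZMod (p ^ k)) :
    MeasurableSet
      ((fun v : Fin 3 → ℤ_[p] => PadicInt.toZModPow k (ternaryForm a b c v)) ⁻¹' {s}) := by
  have : NeZero (p ^ k) := ⟨pow_ne_zero _ (Fact.out : p.Prime).ne_zero⟩
  rw [toZModPow_ternaryForm_preimage, ← Set.biUnion_preimage_singleton]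
  exact (Set.toFinite _).measurableSet_biUnion fun w _ =>
    measurableSet_reduceTriple_preimage_singleton k w

/-- The fibre consists of r_{p^k}(t) residue boxes of volume p^{-3k}, and r·p^{-3k} =
(r/p^{2k})/p^k. -/
theorem padicVol3_real_ternaryForm_fiber (k : ℕ) (a b c t : ℤ) :
    (padicVol3 p).real
      ((fun v : Fin 3 → ℤ_[p] => PadicInt.toZModPow k (ternaryForm a b c v)) ⁻¹' {(t : ZMod (p ^ k))})
      = levelDensity p k a b c t / (p : ℝ) ^ k := by
  classical
  have hp := natCast_prime_pos p
  have : NeZero (p ^ k) := ⟨pow_ne_zero _ (Fact.out : p.Prime).ne_zero⟩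
  have hsum := sum_measureReal_preimage_singleton (μ := padicVol3 p)
    (Finset.univ.filter fun w : Fin 3 → ZMod (p ^ k) => ternaryForm a b c w = t)
    (f := reduceTriple p k) fun w _ => measurableSet_reduceTriple_preimage_singleton k w
  simp only [padicVol3_real_reduceTriple_preimage_singleton, Finset.sum_const, nsmul_eq_mul,
    Finset.coe_filter, Finset.mem_univ, true_and] at hsum
  rw [toZModPow_ternaryForm_preimage, ← hsum, ← localRepNumber_div_eq_levelDensity, localRepNumber,
    Nat.card_eq_fintype_card, Fintype.card_subtype, mul_one_div, div_div, ← pow_add]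
  congr 2
  ring

/-- The part of `U` that consists of full residue classes mod `p^k`. -/
def residueClassesIn (p : ℕ) [Fact p.Prime] (U : Set ℤ_[p]) (k : ℕ) : Set (ZMod (p ^ k)) :=
  {s | PadicInt.toZModPow (p := p) k ⁻¹' {s} ⊆ U}

theorem monotone_residueClassesIn_preimage (U : Set ℤ_[p]) :
    Monotone fun k => PadicInt.toZModPow (p := p) k ⁻¹' residueClassesIn p U k := by
  intro j k hjk x hx y hy
  refine hx ?_
  rw [Set.mem_preimage, Set.mem_singleton_iff, toZModPow_eq_iff_norm_sub_le] at hy ⊢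
  refine hy.trans (zpow_le_zpow_right₀ ?_ (by omega))
  exact_mod_cast (Fact.out : p.Prime).one_le

theorem iUnion_residueClassesIn_preimage {U : Set ℤ_[p]} (hU : IsOpen U) :
    ⋃ k, PadicInt.toZModPow (p := p) k ⁻¹' residueClassesIn p U k = U := by
  refine Set.Subset.antisymm (Set.iUnion_subset fun k x hx => hx rfl) fun x hx => ?_
  obtain ⟨ε, hε, hball⟩ := Metric.isOpen_iff.1 hU x hx
  obtain ⟨k, hk⟩ := PadicInt.exists_pow_neg_lt p hε
  refine Set.mem_iUnion.2 ⟨k, fun y hy => hball ?_⟩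
  rw [Set.mem_preimage, Set.mem_singleton_iff, toZModPow_eq_iff_norm_sub_le, ← dist_eq_norm] at hy
  exact hy.trans_lt hk

theorem tendsto_measureReal_of_monotone {α : Type*} [MeasurableSpace α] {μ : Measure α}
    [IsFiniteMeasure μ] {s : ℕ → Set α} (hs : Monotone s) :
    Tendsto (fun k => μ.real (s k)) atTop (𝓝 (μ.real (⋃ k, s k))) :=
  (ENNReal.tendsto_toReal (measure_ne_top _ _)).comp (tendsto_measure_iUnion_atTop hs)

/-- For a union of classes mod p^k inside U, sum the estimate over the classes; then let k → ∞,
using continuity of measure from below on both sides. No shape of U is assumed beyond openness and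
lying in the class of m mod p^e. -/
theorem abs_padicVol3_sub_le {a b c m : ℤ} {L ε : ℝ} {e : ℕ}
    (h : ∀ k ≥ e, ∀ t : ℤ, (p : ℤ) ^ e ∣ t - m → |levelDensity p k a b c t - L| ≤ ε)
    {U : Set ℤ_[p]} (hU : IsOpen U) (hUm : U ⊆ PadicInt.toZModPow (p := p) e ⁻¹' {(m : ZMod (p ^ e))}) :
    |(padicVol3 p).real (ternaryForm a b c ⁻¹' U) - L * (padicVol p).real U|
      ≤ ε * (padicVol p).real U := by
  have hp := natCast_prime_pos p
  set V : ℕ → Set ℤ_[p] := fun k => PadicInt.toZModPow (p := p) k ⁻¹' residueClassesIn p U k with hV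
  have hVmono : Monotone V := monotone_residueClassesIn_preimage U
  have hVU : ⋃ k, V k = U := iUnion_residueClassesIn_preimage hU
  have h1 : Tendsto (fun k => (padicVol p).real (V k)) atTop (𝓝 ((padicVol p).real U)) := by
    simpa only [hVU] using tendsto_measureReal_of_monotone (μ := padicVol p) hVmono
  have h2 : Tendsto (fun k => (padicVol3 p).real (ternaryForm a b c ⁻¹' V k)) atTop
      (𝓝 ((padicVol3 p).real (ternaryForm a b c ⁻¹' U))) := by
    have := tendsto_measureReal_of_monotone (μ := padicVol3 p)
      (s := fun k => ternaryForm a b c ⁻¹' V k) fun j k hjk => Set.preimage_mono (hVmono hjk)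
    rwa [← Set.preimage_iUnion, hVU] at this
  refine le_of_tendsto_of_tendsto ((h2.sub (h1.const_mul L)).abs) (h1.const_mul ε) ?_
  filter_upwards [eventually_ge_atTop e] with k hk
  have : NeZero (p ^ k) := ⟨pow_ne_zero _ (Fact.out : p.Prime).ne_zero⟩
  classical
  set S : Finset (ZMod (p ^ k)) := (residueClassesIn p U k).toFinset with hS
  have e1 := sum_measureReal_preimage_singleton (μ := padicVol p) S
    (f := PadicInt.toZModPow (p := p) k) fun s _ => (isOpen_toZModPow_preimage k {s}).measurableSet
  have e2 := sum_measureReal_preimage_singleton (μ := padicVol3 p) S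
    (f := fun v : Fin 3 → ℤ_[p] => PadicInt.toZModPow k (ternaryForm a b c v))
    fun s _ => measurableSet_toZModPow_ternaryForm_fiber k a b c s
  rw [hS, Set.coe_toFinset, ← hS] at e1 e2
  change |(padicVol3 p).real ((fun v : Fin 3 → ℤ_[p] =>
    PadicInt.toZModPow k (ternaryForm a b c v)) ⁻¹' residueClassesIn p U k)
      - L * (padicVol p).real (PadicInt.toZModPow (p := p) k ⁻¹' residueClassesIn p U k)|
      ≤ ε * (padicVol p).real (PadicInt.toZModPow (p := p) k ⁻¹' residueClassesIn p U k)
  rw [← e1, ← e2, Finset.mul_sum, Finset.mul_sum, ← Finset.sum_sub_distrib]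
  refine (Finset.abs_sum_le_sum_abs _ _).trans (Finset.sum_le_sum fun s hs => ?_)
  obtain ⟨t, rfl⟩ := ZMod.intCast_surjective s
  have hsub : PadicInt.toZModPow (p := p) k ⁻¹' {(t : ZMod (p ^ k))} ⊆ U := by
    rwa [hS, Set.mem_toFinset] at hs
  -- The integer t lies in its own class, hence in U, hence is congruent to m mod p^e.
  have ht : (p : ℤ) ^ e ∣ t - m := by
    have := hUm (hsub (show PadicInt.toZModPow k (t : ℤ_[p]) ∈ ({(t : ZMod (p ^ k))} : Set _) by simp))
    rw [Set.mem_preimage, map_intCast, Set.mem_singleton_iff, ← sub_eq_zero, ← Int.cast_sub,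
      ZMod.intCast_zmod_eq_zero_iff_dvd] at this
    exact_mod_cast this
  rw [padicVol3_real_ternaryForm_fiber, padicVol_real_residue_fiber, mul_one_div, mul_one_div,
    ← sub_div, abs_div, abs_of_pos (show (0 : ℝ) < (p : ℝ) ^ k by positivity)]
  gcongr
  exact h k hk t ht

theorem hasLocalDensity_of_levelDensity {a b c m : ℤ} {L : ℝ}
    (h : ∀ ε > 0, ∃ e : ℕ, ∀ k ≥ e, ∀ t : ℤ, (p : ℤ) ^ e ∣ t - m →
      |levelDensity p k a b c t - L| ≤ ε) :
    HasLocalDensity p a b c m L := by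
  rw [HasLocalDensity, Metric.tendsto_nhds]
  intro ε hε
  obtain ⟨e, he⟩ := h (ε / 2) (by positivity)
  rw [eventually_inf_principal, eventually_smallSets]
  refine ⟨PadicInt.toZModPow (p := p) e ⁻¹' {(m : ZMod (p ^ e))},
    (isOpen_toZModPow_preimage e _).mem_nhds (by simp), fun U hUm ⟨hU, hmU⟩ => ?_⟩
  -- A nonempty open set has positive Haar measure, so the quotient is genuine.
  have hpos : 0 < (padicVol p).real U :=
    ENNReal.toReal_pos (hU.measure_pos _ ⟨_, hmU⟩).ne' (measure_ne_top _ _)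
  have hle := abs_padicVol3_sub_le he hU hUm
  rw [Real.dist_eq]
  change |(padicVol3 p).real (ternaryForm a b c ⁻¹' U) / (padicVol p).real U - L| < ε
  rw [div_sub' hpos.ne', abs_div, abs_of_pos hpos, div_lt_iff₀ hpos, mul_comm _ L]
  exact hle.trans_lt (by gcongr; linarith)

theorem tendsto_localRepNumber_of_levelDensity {a b c m : ℤ} {L : ℝ}
    (h : ∀ ε > 0, ∃ e : ℕ, ∀ k ≥ e, ∀ t : ℤ, (p : ℤ) ^ e ∣ t - m →
      |levelDensity p k a b c t - L| ≤ ε) :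
    Tendsto (fun k : ℕ => (localRepNumber (p ^ k) a b c m : ℝ) / (p : ℝ) ^ (2 * k)) atTop (𝓝 L) := by
  simp only [localRepNumber_div_eq_levelDensity]
  rw [Metric.tendsto_atTop]
  intro ε hε
  obtain ⟨e, he⟩ := h (ε / 2) (by positivity)
  exact ⟨e, fun k hk => (he k hk m (by simp)).trans_lt (by linarith)⟩

/-- The unit part m₀ enters only through its Legendre symbol, which makes the density locally
constant away from 0. -/
theorem densityFormula_congr {a b₀ c₀ m₀ m₀' : ℤ} (h : (p : ℤ) ∣ m₀ - m₀') (b₁ c₁ m₁ : ℕ) :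
    densityFormula p a b₀ c₀ m₀ b₁ c₁ m₁ = densityFormula p a b₀ c₀ m₀' b₁ c₁ m₁ := by
  have : legR p m₀ = legR p m₀' := legR_congr (by
    rwa [← sub_eq_zero, ← Int.cast_sub, ZMod.intCast_zmod_eq_zero_iff_dvd])
  simp only [densityFormula, legR_mul, this]

theorem not_dvd_of_gcd_eq_one {x : ℤ} (h : Int.gcd x p = 1) : ¬ (p : ℤ) ∣ x := by
  rw [(Nat.prime_iff_prime_int.1 (Fact.out : p.Prime)).coprime_iff_not_dvd.symm, isCoprime_comm]
  exact Int.isCoprime_iff_gcd_eq_one.2 h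

end

end

/-! ### The theorem. -/

theorem theorem1p3 (p : ℕ) [Fact p.Prime] (hp : p ≠ 2)
    (a b c b₀ c₀ : ℤ) (b₁ c₁ : ℕ)
    (ha : ¬ (p : ℤ) ∣ a)
    (hb : b = b₀ * (p : ℤ) ^ b₁) (hb₀ : Int.gcd b₀ p = 1)
    (hc : c = c₀ * (p : ℤ) ^ c₁) (hc₀ : Int.gcd c₀ p = 1)
    (hbc : b₁ ≤ c₁) :
    (∀ (m m₀ : ℤ) (m₁ : ℕ), m ≠ 0 → m = m₀ * (p : ℤ) ^ m₁ → Int.gcd m₀ p = 1 →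
      HasLocalDensity p a b c m (densityFormula p a b₀ c₀ m₀ b₁ c₁ m₁) ∧
      Tendsto (fun k : ℕ => (localRepNumber (p ^ k) a b c m : ℝ) / (p : ℝ) ^ (2 * k)) atTop
        (𝓝 (densityFormula p a b₀ c₀ m₀ b₁ c₁ m₁)) ∧
      ∀ k : ℕ, m₁ < k →
        (localRepNumber (p ^ k) a b c m : ℝ) / (p : ℝ) ^ (2 * k) =
          densityFormula p a b₀ c₀ m₀ b₁ c₁ m₁) ∧
    HasLocalDensity p a b c 0 (densityFormulaZero p a b₀ c₀ b₁ c₁) ∧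
    Tendsto (fun k : ℕ => (localRepNumber (p ^ k) a b c 0 : ℝ) / (p : ℝ) ^ (2 * k)) atTop
      (𝓝 (densityFormulaZero p a b₀ c₀ b₁ c₁)) := by
  subst hb hc
  have hb := not_dvd_of_gcd_eq_one hb₀
  have hc := not_dvd_of_gcd_eq_one hc₀
  refine ⟨?_, ?_⟩
  · rintro _ m₀ m₁ - rfl hm₀
    have hm := not_dvd_of_gcd_eq_one hm₀
    have h : ∀ ε > 0, ∃ e : ℕ, ∀ k ≥ e, ∀ t : ℤ, (p : ℤ) ^ e ∣ t - m₀ * (p : ℤ) ^ m₁ →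
        |levelDensity p k a (b₀ * (p : ℤ) ^ b₁) (c₀ * (p : ℤ) ^ c₁) t
          - densityFormula p a b₀ c₀ m₀ b₁ c₁ m₁| ≤ ε := by
      intro ε hε
      -- Congruence mod p^{m₁+1} preserves both the valuation m₁ and the unit part mod p.
      refine ⟨m₁ + 1, fun k hk t ⟨i, hi⟩ => ?_⟩
      have hti : t = (m₀ + p * i) * (p : ℤ) ^ m₁ := by rw [sub_eq_iff_eq_add.1 hi]; ring
      have hm' : ¬ (p : ℤ) ∣ m₀ + p * i := by rwa [Int.dvd_add_left (dvd_mul_right _ _)]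
      rw [hti, levelDensity_eq_densityFormula hp m₁ ha hb hc hm' hbc (by omega),
        densityFormula_congr (m₀' := m₀) ⟨i, by ring⟩, sub_self, abs_zero]
      exact hε.le
    refine ⟨hasLocalDensity_of_levelDensity h, tendsto_localRepNumber_of_levelDensity h, ?_⟩
    intro k hk
    rw [localRepNumber_div_eq_levelDensity]
    exact levelDensity_eq_densityFormula hp m₁ ha hb hc hm hbc hk
  · have h : ∀ ε > 0, ∃ e : ℕ, ∀ k ≥ e, ∀ t : ℤ, (p : ℤ) ^ e ∣ t - 0 →
        |levelDensity p k a (b₀ * (p : ℤ) ^ b₁) (c₀ * (p : ℤ) ^ c₁) t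
          - densityFormulaZero p a b₀ c₀ b₁ c₁| ≤ ε := by
      intro ε hε
      obtain ⟨e, he⟩ := hasZeroLimit_densityFormulaZero hp ha hb hc hbc ε hε
      refine ⟨e, fun k hk t ⟨i, hi⟩ => ?_⟩
      rw [sub_zero] at hi
      exact hi ▸ he k hk i
    exact ⟨hasLocalDensity_of_levelDensity h, tendsto_localRepNumber_of_levelDensity h⟩
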